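/- **Proposition 4.2.** Let $N\ge 1$, let $q\ge q_c:=1+\frac 2N$, put $q'=\frac{q}{q-1}$, and let $T\in(0,\infty]$. Let $C_{2/q,q'}$ be the Bessel capacity in $\mathbb R^N$, $$C_{2/q,q'}(E)=\inf\Big\{\int_{\mathbb R^N} f^{q'}dy \;:\; f\ge 0 \text{ measurable},\ G_{2/q}*f\ge 1 \text{ on } E\Big\},$$ where $G_{s}$ is the Bessel kernel, i.e. the convolution kernel of $(I-\Delta)^{-s/2}$. For a closed set $F\subset\mathbb R^N$, $x\in\mathbb R^N$ and $t>0$, put $d_n=\sqrt{nt}$, $F_n=\{y\in F: d_n\le |x-y|\le d_{n+1}\}$ and $$W_F(x,t)=t^{-\frac N2}\sum_{n=0}^\infty d_{n+1}^{N-\frac{2}{q-1}}\,e^{-\frac n4}\,C_{2/q,q'}\Big(\frac{F_n}{d_{n+1}}\Big).$$ Let $B_r(x)$ be the open ball of radius $r$ centred at $x$ (empty if $r=0$), and write $\frac Fs\cap B_1(x)$ for the image of $F\cap B_s(x)$ under the dilation $y\mapsto x+\frac{y-x}{s}$ with centre $x$. Let $$a_t=\min\{j\in\mathbb N: F\subset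 B_{\sqrt{jt}}(x)\},\qquad a_t'=\min\{n\in\mathbb N: F\subset B_{\sqrt{(n+1)t}}(x)\},$$ both being $\infty$ if $F$ is unbounded ($a_t=a_t'+1$ if $F$ is bounded and non-empty). Then there exist constants $C_1^\dagger,C_2^\dagger>0$, depending only on $N$, $q$ and $T$, such that for every closed set $F\subset\mathbb R^N$, every $x\in\mathbb R^N$ and every $t\in(0,\infty)$ with $t\le T$, $$C_2^\dagger\, t^{-1-\frac N2}\int_0^{\sqrt{t a_t}} s^{N-\frac2{q-1}}e^{-\frac{s^2}{4t}}\,C_{2/q,q'}\Big(\frac Fs\cap B_1(x)\Big)s\,ds\;\le\; W_F(x,t)\;\le\; C_1^\dagger\, t^{-1-\frac N2}\int_{\sqrt t}^{\sqrt{t(a_t'+2)}} s^{N-\frac2{q-1}}e^{-\frac{s^2}{4t}}\,C_{2/q,q'}\Big(\frac Fs\cap B_1(x)\Big)s\,ds,$$ and all three quantities are finite. -/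

import Mathlib

open Set MeasureTheory Metric
open scoped ENNReal NNReal Pointwise

noncomputable section

namespace ParabolicCapacity

/-- The Bessel kernel of order `s > 0` in `ℝ^N`, i.e. the convolution kernel of
`(I - Δ)^(-s/2)`, whose Fourier transform `∫ G_s(x) e^{-i x·ξ} dx` is `(1 + |ξ|²)^(-s/2)`.
It is given pointwise, with values in `[0, ∞]` (it is `∞` at the origin when `s ≤ N`), by
`G_s(x) = Γ(s/2)⁻¹ ∫₀^∞ (4πτ)^(-N/2) e^{-|x|²/(4τ)} e^{-τ} τ^(s/2 - 1) dτ`. -/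
def besselKernel {N : ℕ} (s : ℝ) (x : EuclideanSpace ℝ (Fin N)) : ℝ≥0∞ :=
  ENNReal.ofReal (Real.Gamma (s / 2))⁻¹ *
    ∫⁻ τ in Ioi (0 : ℝ), ENNReal.ofReal
      ((4 * Real.pi * τ) ^ (-(N : ℝ) / 2) * Real.exp (-‖x‖ ^ 2 / (4 * τ)) *
        Real.exp (-τ) * τ ^ (s / 2 - 1))

/-- The Bessel capacity
`C_{s,p}(E) = inf { ‖f‖_{L^p}^p : f ≥ 0 measurable, G_s * f ≥ 1 everywhere on E }`
of a subset `E` of `ℝ^N`. -/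
def besselCapacity {N : ℕ} (s p : ℝ) (E : Set (EuclideanSpace ℝ (Fin N))) : ℝ≥0∞ :=
  ⨅ (f : EuclideanSpace ℝ (Fin N) → ℝ≥0∞) (_ : Measurable f)
    (_ : ∀ x ∈ E, 1 ≤ ∫⁻ y, besselKernel s (x - y) * f y), ∫⁻ y, f y ^ p

/-- The capacity `C_{2/q, q'}`, where `q' = q / (q - 1)`. -/
def cap {N : ℕ} (q : ℝ) (E : Set (EuclideanSpace ℝ (Fin N))) : ℝ≥0∞ :=
  besselCapacity (2 / q) (q / (q - 1)) E

/-- The radii `d_n = √(n t)`. -/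
def radius (t : ℝ) (n : ℕ) : ℝ := Real.sqrt (n * t)

/-- The slices `F_n = {y ∈ F : d_n ≤ |x - y| ≤ d_{n+1}}`. -/
def slice {N : ℕ} (F : Set (EuclideanSpace ℝ (Fin N))) (x : EuclideanSpace ℝ (Fin N))
    (t : ℝ) (n : ℕ) : Set (EuclideanSpace ℝ (Fin N)) :=
  {y ∈ F | radius t n ≤ ‖x - y‖ ∧ ‖x - y‖ ≤ radius t (n + 1)}

/-- The Bessel parabolic capacitary potential
`W_F(x,t) = t^(-N/2) ∑_{n ≥ 0} d_{n+1}^(N - 2/(q-1)) e^(-n/4) C_{2/q,q'}(F_n / d_{n+1})`. -/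
def capacitaryPotential {N : ℕ} (q : ℝ) (F : Set (EuclideanSpace ℝ (Fin N)))
    (x : EuclideanSpace ℝ (Fin N)) (t : ℝ) : ℝ≥0∞ :=
  ENNReal.ofReal (t ^ (-(N : ℝ) / 2)) *
    ∑' n : ℕ, ENNReal.ofReal
        (radius t (n + 1) ^ ((N : ℝ) - 2 / (q - 1)) * Real.exp (-(n : ℝ) / 4)) *
      cap q ((radius t (n + 1))⁻¹ • slice F x t n)

/-- The smallest integer `j` such that `F ⊆ B_{√(j t)}(x)`, and `∞` if there is none. -/
def lowerIndex {N : ℕ} (F : Set (EuclideanSpace ℝ (Fin N)))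
    (x : EuclideanSpace ℝ (Fin N)) (t : ℝ) : ℕ∞ :=
  ⨅ (j : ℕ) (_ : F ⊆ ball x (Real.sqrt (j * t))), (j : ℕ∞)

/-- The smallest integer `n` such that `F ⊆ B_{√((n+1) t)}(x)`, and `∞` if there is none. -/
def upperIndex {N : ℕ} (F : Set (EuclideanSpace ℝ (Fin N)))
    (x : EuclideanSpace ℝ (Fin N)) (t : ℝ) : ℕ∞ :=
  ⨅ (n : ℕ) (_ : F ⊆ ball x (Real.sqrt ((n + 1) * t))), (n : ℕ∞)

/-- `√(t k)` for `k ∈ {0, 1, 2, …, ∞}`; it is `∞` for `k = ∞` (and `t > 0`). -/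
def sqrtMul (t : ℝ) (k : ℕ∞) : ℝ≥0∞ := (ENNReal.ofReal t * (k : ℝ≥0∞)) ^ (1 / 2 : ℝ)

/-- `t^(-(1+N/2)) ∫_a^b s^(N - 2/(q-1)) e^(-s²/(4t)) C_{2/q,q'}(F/s ∩ B_1(x)) s ds` for
`0 ≤ a` and `b ≤ ∞`, where `F/s` is the dilation of `F` by the factor `1/s` with centre `x`
(so that `F/s ∩ B_1(x)` is the part of `F` in `B_s(x)`, blown up to the unit ball). -/
def capacitaryIntegral {N : ℕ} (q : ℝ) (F : Set (EuclideanSpace ℝ (Fin N)))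
    (x : EuclideanSpace ℝ (Fin N)) (t a : ℝ) (b : ℝ≥0∞) : ℝ≥0∞ :=
  ENNReal.ofReal (t ^ (-(1 + (N : ℝ) / 2))) *
    ∫⁻ s in {s : ℝ | a < s ∧ ENNReal.ofReal s < b},
      ENNReal.ofReal (s ^ ((N : ℝ) - 2 / (q - 1)) * Real.exp (-s ^ 2 / (4 * t))) *
        cap q (AffineMap.homothety x s⁻¹ '' F ∩ ball x 1) * ENNReal.ofReal s

end ParabolicCapacity

end

namespace ParabolicCapacity

/-! Write `C` for the capacity and `m = N - 2/(q-1)`; the condition `q ≥ q_c` says `m ≥ 0`. The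
proof rests on the near homogeneity of `C`: the quantity `ρ^m C(E/ρ)` barely depends on `ρ`. It is
nonincreasing in `ρ` for every `E` (`rpow_mul_cap_le_of_le`), and if `E` lies in a ball of radius `r
≤ ρ`, its value at `r` is at most `K ρ/r` times its value at `ρ` (`rpow_mul_cap_le`). The first fact
is a pointwise kernel inequality. The second (`exists_besselCapacity_smul_le`) splits a potential
into a near part, where the Bessel kernel behaves like the homogeneous one, and a far part, which
Hölder's inequality controls.

The integral is then compared with the series on the intervals between consecutive `d_n`, on each of
which `s ds` has mass of order `t` and the Gaussian is comparable with `e^{-n/4}`. For the lower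
bound, `F ∩ B_s(x)` with `s ≤ d_{n+1}` is covered by the slices `F_0, …, F_n`; subadditivity gives
partial sums, and their sum against `e^{-n/4}` is a Cauchy product with a convergent geometric
series. For the upper bound, `F_n ⊆ F ∩ B_s(x)` when `d_{n+1} < s < d_{n+2}`, and slices beyond
`a_t'` are empty. -/

theorem lintegral_eq_lintegral_comp_smul {E : Type*} [NormedAddCommGroup E] [NormedSpace ℝ E]
    [MeasurableSpace E] [BorelSpace E] [FiniteDimensional ℝ E] (μ : Measure E)
    [μ.IsAddHaarMeasure] {r : ℝ} (hr : 0 < r) (f : E → ℝ≥0∞) :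
    ∫⁻ y, f y ∂μ = ENNReal.ofReal (r ^ Module.finrank ℝ E) * ∫⁻ y, f (r • y) ∂μ := by
  have h1 : ∫⁻ y, f (r • y) ∂μ = ∫⁻ y, f y ∂(Measure.map (r • ·) μ) :=
    (lintegral_map_equiv f (Homeomorph.smulOfNeZero r hr.ne').toMeasurableEquiv).symm
  rw [h1, Measure.map_addHaar_smul μ hr.ne', lintegral_smul_measure, smul_eq_mul, ← mul_assoc,
    ← ENNReal.ofReal_mul (by positivity), abs_of_pos (by positivity),
    mul_inv_cancel₀ (by positivity), ENNReal.ofReal_one, one_mul]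

theorem setLIntegral_Ioi_eq_comp_mul {r : ℝ} (hr : 0 < r) (f : ℝ → ℝ≥0∞) :
    ∫⁻ y in Ioi (0 : ℝ), f y = ENNReal.ofReal r * ∫⁻ y in Ioi (0 : ℝ), f (r * y) := by
  rw [← lintegral_indicator measurableSet_Ioi, ← lintegral_indicator measurableSet_Ioi,
    lintegral_eq_lintegral_comp_smul volume hr]
  simp only [Module.finrank_self, pow_one]
  congr 2
  ext y
  by_cases hy : 0 < y
  · simp [hy, hr]
  · simp [hy, hr]

/-! ### The Bessel kernel: scaling, monotonicity, decay. -/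

variable {N : ℕ}

/-- The Gaussian factor `(4πσ)^(-N/2) e^{-|x|²/(4σ)} σ^(s/2-1)` of the Bessel kernel. -/
noncomputable def gaussFactor {N : ℕ} (s : ℝ) (x : EuclideanSpace ℝ (Fin N)) (σ : ℝ) : ℝ :=
  (4 * Real.pi * σ) ^ (-(N : ℝ) / 2) * Real.exp (-‖x‖ ^ 2 / (4 * σ)) * σ ^ (s / 2 - 1)

theorem gaussFactor_nonneg (s : ℝ) (x : EuclideanSpace ℝ (Fin N)) {σ : ℝ} (hσ : 0 < σ) :
    0 ≤ gaussFactor s x σ := by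
  unfold gaussFactor; positivity

theorem gaussFactor_eq (s : ℝ) (x : EuclideanSpace ℝ (Fin N)) {σ : ℝ} (hσ : 0 < σ) :
    gaussFactor s x σ = (4 * Real.pi) ^ (-(N : ℝ) / 2) *
      (Real.exp (-‖x‖ ^ 2 / (4 * σ)) * σ ^ ((s - N) / 2 - 1)) := by
  have : (s - N) / 2 - 1 = (-(N : ℝ) / 2) + (s / 2 - 1) := by ring
  rw [gaussFactor, Real.mul_rpow (by positivity) hσ.le, this, Real.rpow_add hσ]
  ring

/-- The substitution `τ = r²σ` isolates the homogeneous factor `r^(s-N)`; the only trace of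
inhomogeneity left is the damping `e^{-r²σ}`. -/
theorem besselKernel_smul (s : ℝ) (x : EuclideanSpace ℝ (Fin N)) {r : ℝ} (hr : 0 < r) :
    besselKernel s (r • x) = ENNReal.ofReal (r ^ (s - N)) *
      (ENNReal.ofReal (Real.Gamma (s / 2))⁻¹ *
        ∫⁻ σ in Ioi (0 : ℝ), ENNReal.ofReal (gaussFactor s x σ * Real.exp (-(r ^ 2 * σ)))) := by
  rw [besselKernel, setLIntegral_Ioi_eq_comp_mul (pow_pos hr 2),
    mul_left_comm (ENNReal.ofReal (r ^ (s - (N : ℝ))))]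
  congr 1
  rw [← lintegral_const_mul' _ _ ENNReal.ofReal_ne_top,
    ← lintegral_const_mul' _ _ ENNReal.ofReal_ne_top]
  refine setLIntegral_congr_fun measurableSet_Ioi fun σ hσ => ?_
  have hσ : 0 < σ := hσ
  rw [← ENNReal.ofReal_mul (by positivity), ← ENNReal.ofReal_mul (by positivity)]
  congr 1
  have h1 : (4 * Real.pi * (r ^ 2 * σ)) ^ (-(N : ℝ) / 2) =
      r ^ (-(N : ℝ)) * (4 * Real.pi * σ) ^ (-(N : ℝ) / 2) := by
    rw [show 4 * Real.pi * (r ^ 2 * σ) = r ^ 2 * (4 * Real.pi * σ) by ring,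
      Real.mul_rpow (by positivity) (by positivity), ← Real.rpow_natCast r 2,
      ← Real.rpow_mul hr.le]
    congr 2
    push_cast; ring
  have h2 : (r ^ 2 * σ) ^ (s / 2 - 1) = r ^ (s - 2) * σ ^ (s / 2 - 1) := by
    rw [Real.mul_rpow (by positivity) (by positivity), ← Real.rpow_natCast r 2,
      ← Real.rpow_mul hr.le]
    congr 2
    push_cast; ring
  have h3 : -‖r • x‖ ^ 2 / (4 * (r ^ 2 * σ)) = -‖x‖ ^ 2 / (4 * σ) := by
    rw [norm_smul, Real.norm_of_nonneg hr.le]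
    field_simp
  have h4 : r ^ (s - N) = r ^ 2 * (r ^ (-(N : ℝ)) * r ^ (s - 2)) := by
    rw [← Real.rpow_natCast r 2, ← Real.rpow_add hr, ← Real.rpow_add hr]
    congr 1
    push_cast; ring
  rw [h1, h2, h3, h4, gaussFactor]
  ring

theorem besselKernel_eq (s : ℝ) (x : EuclideanSpace ℝ (Fin N)) :
    besselKernel s x = ENNReal.ofReal (Real.Gamma (s / 2))⁻¹ *
        ∫⁻ σ in Ioi (0 : ℝ), ENNReal.ofReal (gaussFactor s x σ * Real.exp (-σ)) := by
  simpa using besselKernel_smul s x one_pos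

theorem besselKernel_smul_ge_of_le_one (s : ℝ) (x : EuclideanSpace ℝ (Fin N)) {r : ℝ}
    (hr : 0 < r) (hr1 : r ≤ 1) :
    ENNReal.ofReal (r ^ (s - N)) * besselKernel s x ≤ besselKernel s (r • x) := by
  rw [besselKernel_smul s x hr, besselKernel_eq]
  gcongr ENNReal.ofReal (r ^ (s - N)) * (ENNReal.ofReal _ * ?_)
  refine setLIntegral_mono' measurableSet_Ioi fun σ hσ => ENNReal.ofReal_le_ofReal ?_
  have hσ : 0 < σ := hσ
  refine mul_le_mul_of_nonneg_left (Real.exp_le_exp.2 ?_) (gaussFactor_nonneg s x hσ)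
  nlinarith [pow_le_one₀ (n := 2) hr.le hr1]

/-- On bounded sets the Bessel kernel of order `s < N` is comparable with the homogeneous one. -/
theorem exists_besselKernel_smul_ge {s : ℝ} (hsN : s < N) :
    ∃ c : ℝ, 0 < c ∧ ∀ (r : ℝ) (x : EuclideanSpace ℝ (Fin N)), 1 ≤ r → r * ‖x‖ ≤ 4 →
      ENNReal.ofReal (c * r ^ (s - N)) * besselKernel s x ≤ besselKernel s (r • x) := by
  obtain ⟨a, ha⟩ : ∃ a : ℝ, a = (N - s) / 2 := ⟨_, rfl⟩
  have ha0 : 0 < a := by rw [ha]; linarith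
  obtain ⟨D, hD⟩ : ∃ D : ℝ, D = 2 * Real.exp 8 / a := ⟨_, rfl⟩
  have hD0 : 0 < D := by rw [hD]; positivity
  refine ⟨Real.exp (-1) / (1 + D), by positivity, fun r x hr hx => ?_⟩
  have hr0 : 0 < r := by linarith
  rw [besselKernel_smul s x hr0, besselKernel_eq, mul_comm _ (r ^ (s - (N : ℝ))),
    ENNReal.ofReal_mul (by positivity), mul_assoc, mul_left_comm (ENNReal.ofReal (_ / _))]
  refine mul_le_mul_right (mul_le_mul_right ?_ _) _
  -- Split at `σ = r⁻²`. Below `L` the damping `e^{-r²σ}` is at least `e^{-1}`; the part above `L`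
  -- is shown to be at most `D` times the part below.
  obtain ⟨L, hL⟩ : ∃ L : ℝ, L = (r ^ 2)⁻¹ := ⟨_, rfl⟩
  have hL0 : 0 < L := by rw [hL]; positivity
  obtain ⟨c₀, hc₀⟩ : ∃ c₀ : ℝ, c₀ = (4 * Real.pi) ^ (-(N : ℝ) / 2) := ⟨_, rfl⟩
  have hc₀0 : 0 < c₀ := by rw [hc₀]; positivity
  have hg : ∀ σ : ℝ, 0 < σ → gaussFactor s x σ =
      c₀ * (Real.exp (-‖x‖ ^ 2 / (4 * σ)) * σ ^ (-a - 1)) := by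
    intro σ hσ
    rw [gaussFactor_eq s x hσ, hc₀, ha]
    congr 4; ring
  obtain ⟨J, hJ⟩ : ∃ J : ℝ≥0∞, J = ∫⁻ σ in Ioc 0 L, ENNReal.ofReal (gaussFactor s x σ) :=
    ⟨_, rfl⟩
  have hfar : ∫⁻ σ in Ioi L, ENNReal.ofReal (gaussFactor s x σ * Real.exp (-σ)) ≤
      ENNReal.ofReal (c₀ * (L ^ (-a) / a)) := by
    calc _ ≤ ∫⁻ σ in Ioi L, ENNReal.ofReal (c₀ * σ ^ (-a - 1)) := by
          refine setLIntegral_mono' measurableSet_Ioi fun σ hσ => ENNReal.ofReal_le_ofReal ?_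
          have hσ0 : 0 < σ := hL0.trans hσ
          rw [hg σ hσ0, mul_assoc]
          refine mul_le_mul_of_nonneg_left ?_ hc₀0.le
          have h1 : Real.exp (-‖x‖ ^ 2 / (4 * σ)) ≤ 1 := by
            refine Real.exp_le_one_iff.2 (div_nonpos_of_nonpos_of_nonneg ?_ (by positivity))
            nlinarith [sq_nonneg ‖x‖]
          have h2 : Real.exp (-σ) ≤ 1 := Real.exp_le_one_iff.2 (by linarith)
          calc Real.exp (-‖x‖ ^ 2 / (4 * σ)) * σ ^ (-a - 1) * Real.exp (-σ)
              ≤ 1 * σ ^ (-a - 1) * 1 := by gcongr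
            _ = _ := by ring
      _ = ENNReal.ofReal (∫ σ in Ioi L, c₀ * σ ^ (-a - 1)) := by
          rw [ofReal_integral_eq_lintegral_ofReal]
          · exact (integrableOn_Ioi_rpow_of_lt (by linarith) hL0).const_mul _
          · filter_upwards [ae_restrict_mem measurableSet_Ioi] with σ hσ
            have hσ0 : 0 < σ := hL0.trans hσ
            positivity
      _ = _ := by
          rw [integral_const_mul, integral_Ioi_rpow_of_lt (by linarith) hL0]
          congr 2
          rw [show -a - 1 + 1 = -a by ring, neg_div_neg_eq]
  have hnear : ENNReal.ofReal (c₀ * (L ^ (-a) / a)) ≤ ENNReal.ofReal D * J := by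
    have h1 : ENNReal.ofReal (c₀ * (Real.exp (-8) * L ^ (-a - 1)) * (L / 2)) ≤ J := by
      calc _ = ∫⁻ _ in Ioc (L / 2) L, ENNReal.ofReal (c₀ * (Real.exp (-8) * L ^ (-a - 1))) := by
            rw [setLIntegral_const, Real.volume_Ioc, ENNReal.ofReal_mul (by positivity)]
            congr 2; ring
        _ ≤ ∫⁻ σ in Ioc (L / 2) L, ENNReal.ofReal (gaussFactor s x σ) := by
            refine setLIntegral_mono' measurableSet_Ioc fun σ hσ => ENNReal.ofReal_le_ofReal ?_
            have hσ0 : 0 < σ := by linarith [hσ.1]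
            rw [hg σ hσ0]
            -- Here `‖x‖² ≤ 16 L` and `σ ≥ L/2`, whence the constant 8.
            have h2 : -8 ≤ -‖x‖ ^ 2 / (4 * σ) := by
              rw [le_div_iff₀ (by positivity)]
              have h3 : (r * ‖x‖) ^ 2 ≤ 4 ^ 2 := by gcongr
              have h4 : ‖x‖ ^ 2 = L * (r * ‖x‖) ^ 2 := by
                rw [hL]; field_simp
              nlinarith [hσ.1]
            have h5 : L ^ (-a - 1) ≤ σ ^ (-a - 1) :=
              Real.rpow_le_rpow_of_nonpos hσ0 hσ.2 (by linarith)
            gcongr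
        _ ≤ J := by
            rw [hJ]
            exact lintegral_mono_set (Ioc_subset_Ioc_left (by positivity))
    refine le_trans (le_of_eq ?_) (mul_le_mul_right h1 _)
    rw [← ENNReal.ofReal_mul hD0.le, hD, Real.rpow_sub_one hL0.ne', Real.exp_neg]
    congr 1
    field_simp
  have hJle : ENNReal.ofReal (Real.exp (-1)) * J ≤
      ∫⁻ σ in Ioi (0 : ℝ), ENNReal.ofReal (gaussFactor s x σ * Real.exp (-(r ^ 2 * σ))) := by
    rw [hJ, ← lintegral_const_mul' _ _ ENNReal.ofReal_ne_top]
    calc _ ≤ ∫⁻ σ in Ioc 0 L,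
          ENNReal.ofReal (gaussFactor s x σ * Real.exp (-(r ^ 2 * σ))) := by
          refine setLIntegral_mono' measurableSet_Ioc fun σ hσ => ?_
          rw [← ENNReal.ofReal_mul (by positivity), mul_comm]
          refine ENNReal.ofReal_le_ofReal (mul_le_mul_of_nonneg_left (Real.exp_le_exp.2 ?_)
            (gaussFactor_nonneg s x hσ.1))
          have := mul_le_mul_of_nonneg_left hσ.2 (sq_nonneg r)
          rw [hL, mul_inv_cancel₀ (by positivity)] at this
          linarith
      _ ≤ _ := lintegral_mono_set Ioc_subset_Ioi_self
  have htot : ∫⁻ σ in Ioi (0 : ℝ), ENNReal.ofReal (gaussFactor s x σ * Real.exp (-σ)) ≤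
      ENNReal.ofReal (1 + D) * J := by
    rw [← Ioc_union_Ioi_eq_Ioi hL0.le]
    refine (lintegral_union_le _ _ _).trans ?_
    rw [ENNReal.ofReal_add zero_le_one hD0.le, ENNReal.ofReal_one, add_mul, one_mul]
    refine add_le_add ?_ (hfar.trans hnear)
    rw [hJ]
    refine setLIntegral_mono' measurableSet_Ioc fun σ hσ => ENNReal.ofReal_le_ofReal ?_
    exact mul_le_of_le_one_right (gaussFactor_nonneg s x hσ.1)
      (Real.exp_le_one_iff.2 (by linarith [hσ.1]))
  calc _ ≤ ENNReal.ofReal (Real.exp (-1) / (1 + D)) * (ENNReal.ofReal (1 + D) * J) := by gcongr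
    _ = ENNReal.ofReal (Real.exp (-1)) * J := by
        rw [← mul_assoc, ← ENNReal.ofReal_mul (by positivity)]
        congr 2; field_simp
    _ ≤ _ := hJle

theorem measurable_besselKernel (s : ℝ) :
    Measurable (besselKernel s : EuclideanSpace ℝ (Fin N) → ℝ≥0∞) := by
  unfold besselKernel
  refine Measurable.const_mul ?_ _
  refine Measurable.lintegral_prod_right' (f := fun p : EuclideanSpace ℝ (Fin N) × ℝ =>
    ENNReal.ofReal ((4 * Real.pi * p.2) ^ (-(N : ℝ) / 2) * Real.exp (-‖p.1‖ ^ 2 / (4 * p.2)) *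
        Real.exp (-p.2) * p.2 ^ (s / 2 - 1))) ?_
  fun_prop

theorem besselKernel_anti {s : ℝ} {x y : EuclideanSpace ℝ (Fin N)} (h : ‖x‖ ≤ ‖y‖) :
    besselKernel s y ≤ besselKernel s x := by
  rw [besselKernel_eq, besselKernel_eq]
  refine mul_le_mul_right (setLIntegral_mono' measurableSet_Ioi fun σ hσ =>
    ENNReal.ofReal_le_ofReal ?_) _
  have hσ : 0 < σ := hσ
  unfold gaussFactor
  gcongr

theorem besselKernel_pos {s : ℝ} (hs : 0 < s) (x : EuclideanSpace ℝ (Fin N)) :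
    0 < besselKernel s x := by
  rw [besselKernel_eq]
  refine ENNReal.mul_pos ?_ ?_
  · exact (ENNReal.ofReal_pos.2 (inv_pos.2 (Real.Gamma_pos_of_pos (by linarith)))).ne'
  · refine ne_of_gt ?_
    rw [setLIntegral_pos_iff (by unfold gaussFactor; fun_prop)]
    have : Ioi (0 : ℝ) ⊆ (Function.support fun σ =>
        ENNReal.ofReal (gaussFactor s x σ * Real.exp (-σ))) ∩ Ioi 0 := by
      intro σ hσ
      have hσ' : 0 < σ := hσ
      refine ⟨?_, hσ⟩
      rw [Function.mem_support]
      refine (ENNReal.ofReal_pos.2 ?_).ne'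
      unfold gaussFactor; positivity
    exact lt_of_lt_of_le (by simp) (measure_mono this)

/-- Raise `u ≤ e^u` at `u = a/m` to the power `m`. -/
theorem exp_neg_le_rpow_neg {m : ℝ} (hm : 0 < m) {a : ℝ} (ha : 0 < a) :
    Real.exp (-a) ≤ m ^ m * a ^ (-m) := by
  have h1 : a / m ≤ Real.exp (a / m) := by linarith [Real.add_one_le_exp (a / m)]
  have h2 : (a / m) ^ m ≤ Real.exp a := by
    calc (a / m) ^ m ≤ Real.exp (a / m) ^ m := Real.rpow_le_rpow (by positivity) h1 hm.le
      _ = Real.exp a := by rw [← Real.exp_mul, div_mul_cancel₀ _ hm.ne']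
  rw [Real.div_rpow ha.le hm.le, div_le_iff₀ (by positivity)] at h2
  rw [Real.exp_neg, Real.rpow_neg ha.le, ← div_eq_mul_inv, le_div_iff₀ (by positivity),
    inv_mul_le_iff₀ (Real.exp_pos a), mul_comm]
  linarith

/-- Bounding the Gaussian by a power with `m = (N-s+δ)/2` leaves the integral of `e^{-σ} σ^(δ/2-1)`,
which is `Γ(δ/2)`. The surplus `δ` buys extra decay at infinity, needed in the critical case `sp =
N`. -/
theorem exists_besselKernel_le {s δ : ℝ} (hs : 0 < s) (hδ : 0 < δ) (hsN : s < N) :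
    ∃ C : ℝ, 0 < C ∧ ∀ x : EuclideanSpace ℝ (Fin N), x ≠ 0 →
      besselKernel s x ≤ ENNReal.ofReal (C * ‖x‖ ^ (-(N - s + δ))) := by
  obtain ⟨m, hm⟩ : ∃ m : ℝ, m = (N - s + δ) / 2 := ⟨_, rfl⟩
  have hm0 : 0 < m := by rw [hm]; linarith
  have hΓ : 0 < Real.Gamma (s / 2) := Real.Gamma_pos_of_pos (by linarith)
  have hΓ' : 0 < Real.Gamma (δ / 2) := Real.Gamma_pos_of_pos (by linarith)
  obtain ⟨K, hK⟩ : ∃ K : ℝ, K = (4 * Real.pi) ^ (-(N : ℝ) / 2) * (m ^ m * 4 ^ m) := ⟨_, rfl⟩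
  have hK0 : 0 < K := by rw [hK]; positivity
  refine ⟨(Real.Gamma (s / 2))⁻¹ * (K * Real.Gamma (δ / 2)), by positivity, fun x hx => ?_⟩
  have hx0 : 0 < ‖x‖ := norm_pos_iff.2 hx
  have key : ∀ σ : ℝ, 0 < σ → gaussFactor s x σ * Real.exp (-σ) ≤
      K * ‖x‖ ^ (-(N - s + δ)) * (Real.exp (-σ) * σ ^ (δ / 2 - 1)) := by
    intro σ hσ
    have h1 : Real.exp (-‖x‖ ^ 2 / (4 * σ)) ≤
        m ^ m * 4 ^ m * ‖x‖ ^ (-(N - s + δ)) * σ ^ m := by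
      have h := exp_neg_le_rpow_neg hm0 (a := ‖x‖ ^ 2 / (4 * σ)) (by positivity)
      rw [← neg_div] at h
      refine h.trans (le_of_eq ?_)
      rw [Real.div_rpow (by positivity) (by positivity), Real.mul_rpow (by positivity) hσ.le,
        ← Real.rpow_natCast ‖x‖ 2, ← Real.rpow_mul hx0.le, Real.rpow_neg (by norm_num) m,
        Real.rpow_neg hσ.le m, show ((2 : ℕ) : ℝ) * -m = -(N - s + δ) by rw [hm]; push_cast; ring]
      field_simp
    rw [gaussFactor_eq s x hσ]
    have h2 : σ ^ (δ / 2 - 1) = σ ^ m * σ ^ ((s - N) / 2 - 1) := by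
      rw [← Real.rpow_add hσ]; congr 1; rw [hm]; ring
    calc _ ≤ (4 * Real.pi) ^ (-(N : ℝ) / 2) * ((m ^ m * 4 ^ m * ‖x‖ ^ (-(N - s + δ)) * σ ^ m) *
          σ ^ ((s - N) / 2 - 1)) * Real.exp (-σ) := by gcongr
      _ = _ := by rw [h2, hK]; ring
  rw [besselKernel_eq, ENNReal.ofReal_mul' (by positivity), ENNReal.ofReal_mul (by positivity),
    mul_assoc]
  refine mul_le_mul_right ?_ _
  calc _ ≤ ∫⁻ σ in Ioi (0 : ℝ), ENNReal.ofReal (K * ‖x‖ ^ (-(N - s + δ))) *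
        ENNReal.ofReal (Real.exp (-σ) * σ ^ (δ / 2 - 1)) := by
        refine setLIntegral_mono' measurableSet_Ioi fun σ hσ => ?_
        rw [← ENNReal.ofReal_mul (by positivity)]
        exact ENNReal.ofReal_le_ofReal (key σ hσ)
    _ = ENNReal.ofReal (K * ‖x‖ ^ (-(N - s + δ))) * ENNReal.ofReal (Real.Gamma (δ / 2)) := by
        rw [lintegral_const_mul' _ _ ENNReal.ofReal_ne_top,
          Real.Gamma_eq_integral (by linarith : (0 : ℝ) < δ / 2),
          ofReal_integral_eq_lintegral_ofReal (Real.GammaIntegral_convergent (by linarith))]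
        filter_upwards [ae_restrict_mem measurableSet_Ioi] with σ hσ
        have hσ : 0 < σ := hσ
        positivity
    _ = _ := by
        rw [ENNReal.ofReal_mul hK0.le, ENNReal.ofReal_mul hK0.le]; ring

theorem setLIntegral_norm_rpow_lt_top {b : ℝ} (hb : (N : ℝ) < b) :
    ∫⁻ z in {z : EuclideanSpace ℝ (Fin N) | 1 ≤ ‖z‖}, ENNReal.ofReal (‖z‖ ^ (-b)) < ∞ := by
  have hm : MeasurableSet {z : EuclideanSpace ℝ (Fin N) | 1 ≤ ‖z‖} :=
    measurableSet_le measurable_const measurable_norm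
  have hb0 : 0 < b := lt_of_le_of_lt (Nat.cast_nonneg N) hb
  have hfin := finite_integral_one_add_norm (E := EuclideanSpace ℝ (Fin N)) (μ := volume)
    (r := b) (by simpa using hb)
  refine lt_of_le_of_lt ?_ (ENNReal.mul_lt_top (ENNReal.ofReal_lt_top (r := 2 ^ b)) hfin)
  rw [← lintegral_const_mul' _ _ ENNReal.ofReal_ne_top]
  refine le_trans (setLIntegral_mono' hm fun z hz => ?_) (setLIntegral_le_lintegral _ _)
  have hz : 1 ≤ ‖z‖ := hz
  rw [← ENNReal.ofReal_mul (by positivity)]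
  refine ENNReal.ofReal_le_ofReal ?_
  have h0 : 0 < ‖z‖ := by linarith
  calc ‖z‖ ^ (-b) ≤ ((1 + ‖z‖) / 2) ^ (-b) :=
        Real.rpow_le_rpow_of_nonpos (by positivity) (by linarith) (by linarith)
    _ = _ := by
        rw [Real.div_rpow (by positivity) (by norm_num), Real.rpow_neg (by norm_num : (0:ℝ) ≤ 2)]
        field_simp

theorem exists_setLIntegral_besselKernel_rpow_le {s δ r₀ : ℝ} (hs : 0 < s) (hδ : 0 < δ)
    (hsN : s < N) (hr₀ : 0 < r₀) (hN : (N : ℝ) < (N - s + δ) * r₀) :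
    ∃ B : ℝ, 0 < B ∧ ∀ r : ℝ, 0 < r →
      ∫⁻ z in {z : EuclideanSpace ℝ (Fin N) | r ≤ ‖z‖}, besselKernel s z ^ r₀ ≤
        ENNReal.ofReal (B * r ^ (N - (N - s + δ) * r₀)) := by
  obtain ⟨C, hC, hCle⟩ := exists_besselKernel_le (N := N) hs hδ hsN
  obtain ⟨b, hb⟩ : ∃ b : ℝ, b = (N - s + δ) * r₀ := ⟨_, rfl⟩
  rw [← hb] at hN ⊢
  have hI := setLIntegral_norm_rpow_lt_top hN
  obtain ⟨I, hIdef⟩ : ∃ I : ℝ≥0∞, I =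
    ∫⁻ z in {z : EuclideanSpace ℝ (Fin N) | 1 ≤ ‖z‖}, ENNReal.ofReal (‖z‖ ^ (-b)) := ⟨_, rfl⟩
  rw [← hIdef] at hI
  refine ⟨C ^ r₀ * (I.toReal + 1), by positivity, fun r hr => ?_⟩
  have hm : ∀ ρ : ℝ, MeasurableSet {z : EuclideanSpace ℝ (Fin N) | ρ ≤ ‖z‖} := fun ρ =>
    measurableSet_le measurable_const measurable_norm
  have h1 : ∫⁻ z in {z : EuclideanSpace ℝ (Fin N) | r ≤ ‖z‖}, ENNReal.ofReal (‖z‖ ^ (-b)) =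
      ENNReal.ofReal (r ^ (N - b)) * I := by
    rw [← lintegral_indicator (hm r), lintegral_eq_lintegral_comp_smul volume hr, hIdef,
      ← lintegral_indicator (hm 1), finrank_euclideanSpace_fin,
      ← lintegral_const_mul' _ _ ENNReal.ofReal_ne_top,
      ← lintegral_const_mul' _ _ ENNReal.ofReal_ne_top]
    refine lintegral_congr fun z => ?_
    have hiff : r ≤ ‖r • z‖ ↔ 1 ≤ ‖z‖ := by
      rw [norm_smul, Real.norm_of_nonneg hr.le, le_mul_iff_one_le_right hr]
    by_cases hz : 1 ≤ ‖z‖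
    · rw [indicator_of_mem (s := {z | r ≤ ‖z‖}) (hiff.2 hz), indicator_of_mem (show z ∈ _ from hz),
        ← ENNReal.ofReal_mul (by positivity), ← ENNReal.ofReal_mul (by positivity), norm_smul,
        Real.norm_of_nonneg hr.le, Real.mul_rpow hr.le (norm_nonneg _), ← mul_assoc, sub_eq_add_neg,
        Real.rpow_add hr, Real.rpow_natCast]
    · rw [indicator_of_notMem (s := {z | r ≤ ‖z‖}) (fun h => hz (hiff.1 h)),
        indicator_of_notMem (show z ∉ {z | 1 ≤ ‖z‖} from hz), mul_zero, mul_zero]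
  calc _ ≤ ∫⁻ z in {z : EuclideanSpace ℝ (Fin N) | r ≤ ‖z‖},
        ENNReal.ofReal (C ^ r₀) * ENNReal.ofReal (‖z‖ ^ (-b)) := by
        refine setLIntegral_mono' (hm r) fun z hz => ?_
        have hz0 : 0 < ‖z‖ := lt_of_lt_of_le hr hz
        refine (ENNReal.rpow_le_rpow (hCle z (norm_pos_iff.1 hz0)) hr₀.le).trans (le_of_eq ?_)
        rw [ENNReal.ofReal_rpow_of_nonneg (by positivity) hr₀.le,
          Real.mul_rpow hC.le (by positivity), ← Real.rpow_mul hz0.le,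
          ← ENNReal.ofReal_mul (by positivity), hb, neg_mul]
    _ = ENNReal.ofReal (C ^ r₀) * (ENNReal.ofReal (r ^ (N - b)) * ENNReal.ofReal I.toReal) := by
        rw [lintegral_const_mul' _ _ ENNReal.ofReal_ne_top, h1, ENNReal.ofReal_toReal hI.ne]
    _ ≤ _ := by
        rw [← ENNReal.ofReal_mul (by positivity), ← ENNReal.ofReal_mul (by positivity)]
        refine ENNReal.ofReal_le_ofReal ?_
        have : 0 ≤ C ^ r₀ * r ^ (N - b) := by positivity
        nlinarith

/-! ### Bessel capacities: subadditivity, translations, dilations. -/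

theorem besselCapacity_le {s p : ℝ} {E : Set (EuclideanSpace ℝ (Fin N))}
    {f : EuclideanSpace ℝ (Fin N) → ℝ≥0∞} (hf : Measurable f)
    (h : ∀ x ∈ E, 1 ≤ ∫⁻ y, besselKernel s (x - y) * f y) :
    besselCapacity s p E ≤ ∫⁻ y, f y ^ p :=
  iInf_le_of_le f (iInf₂_le hf h)

theorem le_mul_besselCapacity {s p : ℝ} {E : Set (EuclideanSpace ℝ (Fin N))} {c A : ℝ≥0∞}
    (hA : A ≠ 0) (hA' : A ≠ ∞)
    (h : ∀ f : EuclideanSpace ℝ (Fin N) → ℝ≥0∞, Measurable f →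
      (∀ x ∈ E, 1 ≤ ∫⁻ y, besselKernel s (x - y) * f y) → c ≤ A * ∫⁻ y, f y ^ p) :
    c ≤ A * besselCapacity s p E :=
  (ENNReal.div_le_iff' hA hA').1 <| le_iInf fun f => le_iInf₂ fun hf hE =>
    (ENNReal.div_le_iff' hA hA').2 (h f hf hE)

theorem besselCapacity_mono {s p : ℝ} {E E' : Set (EuclideanSpace ℝ (Fin N))} (h : E ⊆ E') :
    besselCapacity s p E ≤ besselCapacity s p E' :=
  le_iInf fun _ => le_iInf₂ fun hf hE => besselCapacity_le hf fun x hx => hE x (h hx)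

theorem besselCapacity_empty (s : ℝ) {p : ℝ} (hp : 0 < p) :
    besselCapacity s p (∅ : Set (EuclideanSpace ℝ (Fin N))) = 0 := by
  refine le_antisymm ((besselCapacity_le (f := fun _ => 0) measurable_const (by simp)).trans ?_)
    zero_le
  simp [hp]

/-- The maximum of two test functions serves the union, and `max(f, g)^p ≤ f^p + g^p` pointwise. -/
theorem besselCapacity_union_le (s p : ℝ) (E E' : Set (EuclideanSpace ℝ (Fin N))) :
    besselCapacity s p (E ∪ E') ≤ besselCapacity s p E + besselCapacity s p E' := by
  conv_rhs => unfold besselCapacity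
  simp only [ENNReal.iInf_add, ENNReal.add_iInf]
  refine le_iInf fun g => le_iInf fun hg => le_iInf fun hE' => le_iInf fun f => le_iInf fun hf =>
    le_iInf fun hE => ?_
  refine (besselCapacity_le (hf.max hg) ?_).trans ?_
  · rintro x (hx | hx)
    · exact (hE x hx).trans (lintegral_mono fun y => mul_le_mul_right (le_max_left _ _) _)
    · exact (hE' x hx).trans (lintegral_mono fun y => mul_le_mul_right (le_max_right _ _) _)
  · rw [← lintegral_add_left (hf.pow_const p)]
    refine lintegral_mono fun y => ?_
    rcases le_total (f y) (g y) with h | h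
    · simp only [max_eq_right h]; exact le_add_self
    · simp only [max_eq_left h]; exact le_self_add

theorem besselCapacity_biUnion_range_le (s : ℝ) {p : ℝ} (hp : 0 < p)
    (E : ℕ → Set (EuclideanSpace ℝ (Fin N))) (n : ℕ) :
    besselCapacity s p (⋃ k ∈ Finset.range n, E k) ≤
      ∑ k ∈ Finset.range n, besselCapacity s p (E k) := by
  induction n with
  | zero => simp [besselCapacity_empty s hp]
  | succ n ih =>
    rw [Finset.sum_range_succ, Finset.range_add_one, Finset.set_biUnion_insert, union_comm]
    exact (besselCapacity_union_le s p _ _).trans (by gcongr)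

theorem besselCapacity_vadd_le (s p : ℝ) (v : EuclideanSpace ℝ (Fin N))
    (E : Set (EuclideanSpace ℝ (Fin N))) :
    besselCapacity s p (v +ᵥ E) ≤ besselCapacity s p E := by
  refine le_iInf fun f => le_iInf₂ fun hf hE => ?_
  rw [← lintegral_sub_right_eq_self (fun y => f y ^ p) v]
  refine besselCapacity_le (f := fun y => f (y - v)) (by fun_prop) ?_
  rintro _ ⟨x, hx, rfl⟩
  refine (hE x hx).trans (le_of_eq ?_)
  rw [← lintegral_sub_right_eq_self (fun y => besselKernel s (x - y) * f y) v]
  refine lintegral_congr fun y => ?_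
  simp only [vadd_eq_add]
  congr 2; abel

theorem besselCapacity_vadd (s p : ℝ) (v : EuclideanSpace ℝ (Fin N))
    (E : Set (EuclideanSpace ℝ (Fin N))) :
    besselCapacity s p (v +ᵥ E) = besselCapacity s p E := by
  refine le_antisymm (besselCapacity_vadd_le s p v E) ?_
  simpa using besselCapacity_vadd_le s p (-v) (v +ᵥ E)

/-- The test function for `r • E` is `κ f(·/r)`. Both scaling estimates use it with `κ` a multiple
of `r^(-s)`. -/
theorem besselCapacity_smul_le_lintegral {s p : ℝ} (hp : 0 ≤ p) {r : ℝ} (hr : 0 < r) {κ : ℝ}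
    (hκ : 0 ≤ κ) {E : Set (EuclideanSpace ℝ (Fin N))} {f : EuclideanSpace ℝ (Fin N) → ℝ≥0∞}
    (hf : Measurable f)
    (h : ∀ x ∈ E, 1 ≤ ENNReal.ofReal (κ * r ^ N) *
      ∫⁻ y, besselKernel s (r • (x - y)) * f y) :
    besselCapacity s p (r • E) ≤ ENNReal.ofReal (κ ^ p * r ^ N) * ∫⁻ y, f y ^ p := by
  refine (besselCapacity_le (f := fun y => ENNReal.ofReal κ * f (r⁻¹ • y)) (by fun_prop) ?_).trans
    (le_of_eq ?_)
  · rintro _ ⟨x, hx, rfl⟩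
    refine (h x hx).trans (le_of_eq ?_)
    rw [lintegral_eq_lintegral_comp_smul volume hr
      (fun y => besselKernel s (r • x - y) * (ENNReal.ofReal κ * f (r⁻¹ • y))),
      finrank_euclideanSpace_fin, mul_comm κ, ENNReal.ofReal_mul (by positivity), mul_assoc,
      ← lintegral_const_mul' _ _ ENNReal.ofReal_ne_top]
    congr 1
    refine lintegral_congr fun y => ?_
    rw [inv_smul_smul₀ hr.ne', smul_sub, mul_left_comm]
  · rw [lintegral_eq_lintegral_comp_smul volume hr
      (fun y => (ENNReal.ofReal κ * f (r⁻¹ • y)) ^ p),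
      finrank_euclideanSpace_fin, mul_comm (κ ^ p), ENNReal.ofReal_mul (by positivity), mul_assoc,
      ← lintegral_const_mul' (ENNReal.ofReal (κ ^ p)) _ ENNReal.ofReal_ne_top]
    congr 1
    refine lintegral_congr fun y => ?_
    rw [inv_smul_smul₀ hr.ne', ENNReal.mul_rpow_of_nonneg _ _ hp,
      ENNReal.ofReal_rpow_of_nonneg hκ hp]

theorem besselCapacity_smul_le_of_le_one {s p : ℝ} (hp : 0 ≤ p) {r : ℝ} (hr : 0 < r)
    (hr1 : r ≤ 1) (E : Set (EuclideanSpace ℝ (Fin N))) :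
    besselCapacity s p (r • E) ≤ ENNReal.ofReal (r ^ (N - s * p)) * besselCapacity s p E := by
  refine le_mul_besselCapacity (ENNReal.ofReal_pos.2 (by positivity)).ne' ENNReal.ofReal_ne_top
    fun f hf hE => ?_
  refine (besselCapacity_smul_le_lintegral (κ := r ^ (-s)) (f := f) hp hr (by positivity) hf
    fun x hx => ?_).trans (le_of_eq ?_)
  · refine (hE x hx).trans ?_
    rw [← lintegral_const_mul' _ _ ENNReal.ofReal_ne_top]
    refine lintegral_mono fun y => ?_
    rw [← mul_assoc]
    refine mul_le_mul_left ?_ _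
    refine le_trans (le_of_eq ?_) (mul_le_mul_right (besselKernel_smul_ge_of_le_one s _ hr hr1) _)
    rw [← mul_assoc, ← ENNReal.ofReal_mul (by positivity), ← Real.rpow_natCast, ← Real.rpow_add hr,
      ← Real.rpow_add hr]
    simp
  · rw [← Real.rpow_mul hr.le, ← Real.rpow_natCast, ← Real.rpow_add hr]
    congr 3; ring

/-- Points of the unit ball are at distance at most 2, so the radially decreasing kernel has a
positive lower bound there, and a constant on the ball is a test function. -/
theorem besselCapacity_closedBall_lt_top {s p : ℝ} (hN : 1 ≤ N) (hs : 0 < s) (hp : 0 < p) :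
    besselCapacity s p (closedBall (0 : EuclideanSpace ℝ (Fin N)) 1) < ∞ := by
  have : NeZero N := ⟨by omega⟩
  obtain ⟨v, hv⟩ := exists_norm_eq (EuclideanSpace ℝ (Fin N)) (zero_le_two (α := ℝ))
  -- Truncation at 1 makes `g` finite without an upper bound on the kernel.
  obtain ⟨g, hg⟩ : ∃ g : ℝ≥0∞, g = min (besselKernel s v) 1 := ⟨_, rfl⟩
  obtain ⟨V, hV⟩ : ∃ V : ℝ≥0∞, V = volume (closedBall (0 : EuclideanSpace ℝ (Fin N)) 1) :=
    ⟨_, rfl⟩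
  have hg0 : g ≠ 0 := by rw [hg]; exact (lt_min (besselKernel_pos hs v) one_pos).ne'
  have hgt : g ≠ ∞ := by rw [hg]; exact ne_top_of_le_ne_top ENNReal.one_ne_top (min_le_right _ _)
  have hV0 : V ≠ 0 := by rw [hV]; exact (measure_closedBall_pos _ _ one_pos).ne'
  have hVt : V ≠ ∞ := by rw [hV]; exact measure_closedBall_lt_top.ne
  have hc : (g * V)⁻¹ ≠ ∞ := ENNReal.inv_ne_top.2 (mul_ne_zero hg0 hV0)
  refine (besselCapacity_le (f := (closedBall 0 1).indicator fun _ => (g * V)⁻¹)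
    (measurable_const.indicator measurableSet_closedBall) fun x hx => ?_).trans_lt ?_
  · calc (1 : ℝ≥0∞) = ∫⁻ _ in closedBall (0 : EuclideanSpace ℝ (Fin N)) 1, g * (g * V)⁻¹ := by
          rw [setLIntegral_const, ← hV, mul_right_comm, ENNReal.mul_inv_cancel (mul_ne_zero hg0 hV0)
            (ENNReal.mul_ne_top hgt hVt)]
      _ ≤ ∫⁻ y in closedBall (0 : EuclideanSpace ℝ (Fin N)) 1,
            besselKernel s (x - y) * (g * V)⁻¹ := by
          refine setLIntegral_mono' measurableSet_closedBall fun y hy => mul_le_mul_left ?_ _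
          rw [hg]
          refine (min_le_left _ _).trans (besselKernel_anti ?_)
          rw [hv]
          rw [mem_closedBall_zero_iff] at hx hy
          linarith [norm_sub_le x y]
      _ = _ := by
          rw [← lintegral_indicator measurableSet_closedBall]
          refine lintegral_congr fun y => ?_
          by_cases hy : y ∈ closedBall (0 : EuclideanSpace ℝ (Fin N)) 1
          · simp only [indicator_of_mem hy]
          · simp only [indicator_of_notMem hy, mul_zero]
  · calc _ = ∫⁻ _ in closedBall (0 : EuclideanSpace ℝ (Fin N)) 1, ((g * V)⁻¹) ^ p := by
          rw [← lintegral_indicator measurableSet_closedBall]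
          refine lintegral_congr fun y => ?_
          by_cases hy : y ∈ closedBall (0 : EuclideanSpace ℝ (Fin N)) 1
          · simp only [indicator_of_mem hy]
          · simp only [indicator_of_notMem hy, ENNReal.zero_rpow_of_pos hp]
      _ < ∞ := by
          rw [setLIntegral_const, ← hV]
          exact ENNReal.mul_lt_top (ENNReal.rpow_lt_top_of_nonneg hp.le hc) hVt.lt_top

/-- If `f` has a large potential far from its support, then its norm is bounded from below. -/
theorem exists_one_le_mul_lintegral_rpow {s p : ℝ} (hs : 0 < s) (hp : 1 < p) (hsp : s * p ≤ N) :
    ∃ K : ℝ, 0 < K ∧ ∀ (r : ℝ) (x : EuclideanSpace ℝ (Fin N))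
      (S : Set (EuclideanSpace ℝ (Fin N))) (f : EuclideanSpace ℝ (Fin N) → ℝ≥0∞), 0 < r →
      MeasurableSet S → Measurable f → (∀ y ∈ S, r⁻¹ ≤ ‖x - y‖) →
      2⁻¹ ≤ ∫⁻ y in S, besselKernel s (x - y) * f y →
      1 ≤ ENNReal.ofReal (K * r ^ (N - s * p + 1)) * ∫⁻ y, f y ^ p := by
  have hp0 : 0 < p := by linarith
  have hp1 : 0 < p - 1 := by linarith
  have hsN : s < N := lt_of_lt_of_le (by nlinarith) hsp
  have hpq : p.HolderConjugate (p / (p - 1)) := Real.HolderConjugate.conjExponent hp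
  have hq : 0 < p / (p - 1) := by positivity
  -- With `δ = 1/p` the dual power of the kernel is integrable at infinity even when `sp = N`. This
  -- choice produces the `+ 1` in the exponent of `r`.
  have hexp : (N - s + 1 / p) * (p / (p - 1)) * (p - 1) = N * p - s * p + 1 := by
    field_simp
  obtain ⟨B, hB, hBle⟩ := exists_setLIntegral_besselKernel_rpow_le (N := N) (r₀ := p / (p - 1)) hs
    (one_div_pos.2 hp0) hsN hq (lt_of_mul_lt_mul_right (by rw [hexp]; nlinarith) hp1.le)
  refine ⟨2 ^ p * B ^ (p - 1), by positivity, fun r x S f hr hS hf hSx hI => ?_⟩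
  have hmeas : Measurable fun y => besselKernel s (x - y) :=
    (measurable_besselKernel s).comp (measurable_const.sub measurable_id)
  have h1 : ∫⁻ y in S, besselKernel s (x - y) ^ (p / (p - 1)) ≤
      ENNReal.ofReal (B * r⁻¹ ^ (N - (N - s + 1 / p) * (p / (p - 1)))) := by
    refine le_trans ?_ (hBle r⁻¹ (inv_pos.2 hr))
    rw [← lintegral_indicator hS, ← lintegral_indicator
      (measurableSet_le measurable_const measurable_norm), ← lintegral_sub_left_eq_self
      ({z | r⁻¹ ≤ ‖z‖}.indicator fun z => besselKernel s z ^ (p / (p - 1))) x]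
    refine lintegral_mono fun y => ?_
    by_cases hy : y ∈ S
    · rw [indicator_of_mem hy, indicator_of_mem (show x - y ∈ _ from hSx y hy)]
    · rw [indicator_of_notMem hy]; exact zero_le
  have h2 := (hI.trans (ENNReal.lintegral_mul_le_Lp_mul_Lq (volume.restrict S) hpq.symm
    hmeas.aemeasurable hf.aemeasurable))
  have h3 := ENNReal.rpow_le_rpow h2 hp0.le
  rw [ENNReal.mul_rpow_of_nonneg _ _ hp0.le, ← ENNReal.rpow_mul, ← ENNReal.rpow_mul,
    one_div_mul_cancel hp0.ne', ENNReal.rpow_one,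
    show 1 / (p / (p - 1)) * p = p - 1 by field_simp] at h3
  have h4 : (∫⁻ y in S, besselKernel s (x - y) ^ (p / (p - 1))) ^ (p - 1) ≤
      ENNReal.ofReal (B ^ (p - 1) * r ^ (N - s * p + 1)) := by
    refine (ENNReal.rpow_le_rpow h1 hp1.le).trans (le_of_eq ?_)
    rw [ENNReal.ofReal_rpow_of_nonneg (by positivity) hp1.le,
      Real.mul_rpow hB.le (by positivity), Real.inv_rpow hr.le, ← Real.rpow_neg hr.le,
      ← Real.rpow_mul hr.le]
    congr 3
    linarith [hexp]
  have h5 : (2⁻¹ : ℝ≥0∞) ^ p ≤ ENNReal.ofReal (B ^ (p - 1) * r ^ (N - s * p + 1)) *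
      ∫⁻ y, f y ^ p :=
    h3.trans (mul_le_mul' h4 (setLIntegral_le_lintegral _ _))
  calc (1 : ℝ≥0∞) = ENNReal.ofReal (2 ^ p) * 2⁻¹ ^ p := by
        rw [← ENNReal.ofReal_rpow_of_nonneg zero_le_two hp0.le,
          ← ENNReal.mul_rpow_of_nonneg _ _ hp0.le, ENNReal.ofReal_ofNat,
          ENNReal.mul_inv_cancel two_ne_zero ENNReal.ofNat_ne_top, ENNReal.one_rpow]
    _ ≤ _ := mul_le_mul_right h5 _
    _ = _ := by rw [← mul_assoc, ← ENNReal.ofReal_mul (by positivity), mul_assoc]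

/-- Dilating a set inside the unit ball by a factor `r ≥ 1` increases its Bessel capacity at most
by a power of `r`. -/
theorem exists_besselCapacity_smul_le {s p : ℝ} (hN : 1 ≤ N) (hs : 0 < s) (hp : 1 < p)
    (hsp : s * p ≤ N) :
    ∃ K : ℝ, 0 < K ∧ ∀ (r : ℝ) (E : Set (EuclideanSpace ℝ (Fin N))), 1 ≤ r →
      E ⊆ closedBall 0 r⁻¹ →
      besselCapacity s p (r • E) ≤
        ENNReal.ofReal (K * r ^ (N - s * p + 1)) * besselCapacity s p E := by
  have hp0 : 0 < p := by linarith
  have hsN : s < N := lt_of_lt_of_le (by nlinarith) hsp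
  obtain ⟨K₁, hK₁, hfar⟩ := exists_one_le_mul_lintegral_rpow hs hp hsp
  obtain ⟨c, hc, hloc⟩ := exists_besselKernel_smul_ge (N := N) hsN
  have hM := besselCapacity_closedBall_lt_top hN hs hp0
  obtain ⟨M, hMdef⟩ : ∃ M : ℝ≥0∞,
    M = besselCapacity s p (closedBall (0 : EuclideanSpace ℝ (Fin N)) 1) := ⟨_, rfl⟩
  rw [← hMdef] at hM
  refine ⟨(2 / c) ^ p + M.toReal * K₁, by positivity, fun r E hr hE => ?_⟩
  have hr0 : 0 < r := by linarith
  refine le_mul_besselCapacity (ENNReal.ofReal_pos.2 (by positivity)).ne' ENNReal.ofReal_ne_top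
    fun f hf hfE => ?_
  obtain ⟨S, hS⟩ : ∃ S : Set (EuclideanSpace ℝ (Fin N)), S = {y | ‖y‖ ≤ 3 * r⁻¹} := ⟨_, rfl⟩
  have hSm : MeasurableSet S := by rw [hS]; exact measurableSet_le measurable_norm measurable_const
  have hEn : ∀ x ∈ E, ‖x‖ ≤ r⁻¹ := fun x hx => mem_closedBall_zero_iff.1 (hE hx)
  -- If at some point of `E` half of the potential comes from outside `S`, then `‖f‖_p^p` is already
  -- so large that the crude bound by the capacity `M` of the unit ball suffices. Otherwise the part
  -- of `f` in `S` contributes at least half on all of `E`, and there `r‖x - y‖ ≤ 4`, so the kernel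
  -- scales almost homogeneously.
  by_cases hcase : ∃ x ∈ E, 2⁻¹ ≤ ∫⁻ y in Sᶜ, besselKernel s (x - y) * f y
  · obtain ⟨x, hx, hI⟩ := hcase
    have h1 := hfar r x Sᶜ f hr0 hSm.compl hf (fun y hy => by
      rw [hS, mem_compl_iff, mem_ofPred_eq, not_le] at hy
      have := hEn x hx
      have h2 := norm_sub_norm_le y x
      rw [norm_sub_rev] at h2
      have : 0 < r⁻¹ := inv_pos.2 hr0
      linarith) hI
    calc besselCapacity s p (r • E) ≤ M := by
          rw [hMdef]
          refine besselCapacity_mono ?_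
          rintro _ ⟨y, hy, rfl⟩
          rw [mem_closedBall_zero_iff]
          simp only [norm_smul, Real.norm_of_nonneg hr0.le]
          calc r * ‖y‖ ≤ r * r⁻¹ := by gcongr; exact hEn y hy
            _ = 1 := mul_inv_cancel₀ hr0.ne'
      _ ≤ M * (ENNReal.ofReal (K₁ * r ^ (N - s * p + 1)) * ∫⁻ y, f y ^ p) :=
          le_mul_of_one_le_right' h1
      _ = ENNReal.ofReal (M.toReal * K₁ * r ^ (N - s * p + 1)) * ∫⁻ y, f y ^ p := by
          rw [mul_assoc M.toReal, ENNReal.ofReal_mul ENNReal.toReal_nonneg,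
            ENNReal.ofReal_toReal hM.ne, mul_assoc]
      _ ≤ _ := by
          refine mul_le_mul_left (ENNReal.ofReal_le_ofReal ?_) _
          gcongr
          exact le_add_of_nonneg_left (by positivity)
  · have hnear : ∀ x ∈ E, 2⁻¹ ≤ ∫⁻ y in S, besselKernel s (x - y) * f y := by
      intro x hx
      by_contra hlt
      refine absurd (hfE x hx) (not_le.2 ?_)
      rw [← lintegral_add_compl _ hSm, ← ENNReal.inv_two_add_inv_two]
      exact ENNReal.add_lt_add (not_le.1 hlt) (not_le.1 fun h => hcase ⟨x, hx, h⟩)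
    refine (besselCapacity_smul_le_lintegral (κ := 2 / c * r ^ (-s)) (f := f) hp0.le hr0
      (by positivity) hf fun x hx => ?_).trans ?_
    · calc (1 : ℝ≥0∞) = ENNReal.ofReal 2 * 2⁻¹ := by
            rw [ENNReal.ofReal_ofNat, ENNReal.mul_inv_cancel two_ne_zero ENNReal.ofNat_ne_top]
        _ ≤ ENNReal.ofReal 2 * ∫⁻ y in S, besselKernel s (x - y) * f y :=
            mul_le_mul_right (hnear x hx) _
        _ ≤ ENNReal.ofReal (2 / c * r ^ (-s) * r ^ N) *
              ∫⁻ y in S, besselKernel s (r • (x - y)) * f y := by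
            rw [← lintegral_const_mul' _ _ ENNReal.ofReal_ne_top,
              ← lintegral_const_mul' _ _ ENNReal.ofReal_ne_top]
            refine setLIntegral_mono' hSm fun y hy => ?_
            rw [← mul_assoc, ← mul_assoc]
            refine mul_le_mul_left ?_ _
            rw [hS, mem_ofPred_eq] at hy
            have h4 : r * ‖x - y‖ ≤ 4 := by
              have h5 : ‖x - y‖ ≤ 4 * r⁻¹ := by linarith [norm_sub_le x y, hEn x hx]
              calc r * ‖x - y‖ ≤ r * (4 * r⁻¹) := by gcongr
                _ = 4 := by field_simp
            refine le_trans (le_of_eq ?_) (mul_le_mul_right (hloc r (x - y) hr h4) _)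
            rw [← mul_assoc, ← ENNReal.ofReal_mul (by positivity)]
            congr 2
            have : r ^ (-s) * r ^ N * r ^ (s - N) = 1 := by
              rw [← Real.rpow_natCast, ← Real.rpow_add hr0, ← Real.rpow_add hr0]
              simp
            calc (2 : ℝ) = 2 / c * c * 1 := by field_simp
              _ = _ := by rw [← this]; ring
        _ ≤ _ := mul_le_mul_right (setLIntegral_le_lintegral _ _) _
    · refine mul_le_mul_left (ENNReal.ofReal_le_ofReal ?_) _
      rw [Real.mul_rpow (by positivity) (by positivity), ← Real.rpow_mul hr0.le, mul_assoc,
        ← Real.rpow_natCast, ← Real.rpow_add hr0]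
      have h6 : r ^ (-s * p + N) ≤ r ^ (N - s * p + 1) :=
        Real.rpow_le_rpow_of_exponent_le hr (by linarith)
      have h7 : 0 ≤ M.toReal * K₁ := by positivity
      gcongr
      linarith

/-! ### The capacity `C_{2/q,q'}` under dilations. -/

theorem two_div_sub_one_nonneg_le {q : ℝ} (hN : 1 ≤ N) (hq : 1 + 2 / (N : ℝ) ≤ q) :
    1 < q ∧ 2 / (q - 1) ≤ N ∧ 2 / q * (q / (q - 1)) = 2 / (q - 1) := by
  have hN0 : (0 : ℝ) < N := by exact_mod_cast hN
  have h : 0 < 2 / (N : ℝ) := by positivity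
  have hq1 : 0 < q - 1 := by linarith
  refine ⟨by linarith, ?_, ?_⟩
  · rw [div_le_iff₀ hq1, ← div_le_iff₀' hN0]; linarith
  · have : q ≠ 0 := by linarith
    field_simp

theorem cap_mono (q : ℝ) {E E' : Set (EuclideanSpace ℝ (Fin N))} (h : E ⊆ E') :
    cap q E ≤ cap q E' := besselCapacity_mono h

theorem cap_smul_le_of_le_one {q : ℝ} (hN : 1 ≤ N) (hq : 1 + 2 / (N : ℝ) ≤ q) {r : ℝ} (hr : 0 < r)
    (hr1 : r ≤ 1) (E : Set (EuclideanSpace ℝ (Fin N))) :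
    cap q (r • E) ≤ ENNReal.ofReal (r ^ (N - 2 / (q - 1))) * cap q E := by
  obtain ⟨hq1, -, h⟩ := two_div_sub_one_nonneg_le hN hq
  rw [← h]
  exact besselCapacity_smul_le_of_le_one
    (div_nonneg (by linarith) (by linarith)) hr hr1 E

theorem exists_cap_smul_le {q : ℝ} (hN : 1 ≤ N) (hq : 1 + 2 / (N : ℝ) ≤ q) :
    ∃ K : ℝ, 0 < K ∧ ∀ (r : ℝ) (x : EuclideanSpace ℝ (Fin N)) (E : Set (EuclideanSpace ℝ (Fin N))),
      1 ≤ r → E ⊆ closedBall x r⁻¹ →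
      cap q (r • E) ≤ ENNReal.ofReal (K * r ^ (N - 2 / (q - 1) + 1)) * cap q E := by
  obtain ⟨hq1, hle, h⟩ := two_div_sub_one_nonneg_le hN hq
  rw [← h] at hle
  obtain ⟨K, hK, hKle⟩ := exists_besselCapacity_smul_le (s := 2 / q) (p := q / (q - 1)) hN
    (by positivity) (by rw [one_lt_div (by linarith)]; linarith) hle
  rw [h] at hKle
  refine ⟨K, hK, fun r x E hr hE => ?_⟩
  have h1 := hKle r (-x +ᵥ E) hr (by
    rintro _ ⟨y, hy, rfl⟩
    have := hE hy
    rw [mem_closedBall, dist_eq_norm] at this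
    rw [mem_closedBall_zero_iff]
    simpa [neg_add_eq_sub] using this)
  rw [besselCapacity_vadd] at h1
  have h2 : r • (-x +ᵥ E) = (r • -x) +ᵥ r • E := by
    ext z
    constructor
    · rintro ⟨_, ⟨y, hy, rfl⟩, rfl⟩
      exact ⟨r • y, ⟨y, hy, rfl⟩, by simp⟩
    · rintro ⟨_, ⟨y, hy, rfl⟩, rfl⟩
      exact ⟨-x + y, ⟨y, hy, rfl⟩, by simp⟩
  rwa [h2, besselCapacity_vadd] at h1

theorem cap_ball_lt_top {q : ℝ} (hN : 1 ≤ N) (hq : 1 + 2 / (N : ℝ) ≤ q)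
    (x : EuclideanSpace ℝ (Fin N)) : cap q (ball x 1) < ∞ := by
  obtain ⟨hq1, -, -⟩ := two_div_sub_one_nonneg_le hN hq
  have h := besselCapacity_closedBall_lt_top (s := 2 / q) (p := q / (q - 1)) hN
    (by positivity) (div_pos (by linarith) (by linarith))
  refine lt_of_le_of_lt ?_ h
  rw [← besselCapacity_vadd _ _ x]
  refine besselCapacity_mono fun y hy => ⟨y - x, ?_, by simp⟩
  rw [mem_closedBall_zero_iff, ← dist_eq_norm]
  exact (mem_ball.1 hy).le

/-- Dilations centred at `x` and at the origin differ by a translation, which the capacity does not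
see. -/
theorem cap_homothety {q : ℝ} (F : Set (EuclideanSpace ℝ (Fin N))) (x : EuclideanSpace ℝ (Fin N))
    {s : ℝ} (hs : 0 < s) :
    cap q (AffineMap.homothety x s⁻¹ '' F ∩ ball x 1) = cap q (s⁻¹ • (F ∩ ball x s)) := by
  have h : AffineMap.homothety x s⁻¹ '' F ∩ ball x 1 =
      (x - s⁻¹ • x) +ᵥ (s⁻¹ • (F ∩ ball x s)) := by
    have hmem : ∀ y : EuclideanSpace ℝ (Fin N),
        AffineMap.homothety x s⁻¹ y ∈ ball x 1 ↔ y ∈ ball x s := by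
      intro y
      rw [mem_ball, mem_ball, dist_homothety_center, norm_inv, Real.norm_of_nonneg hs.le,
        dist_comm x y, inv_mul_lt_iff₀ hs, mul_one]
    have heq : ∀ y : EuclideanSpace ℝ (Fin N),
        AffineMap.homothety x s⁻¹ y = (x - s⁻¹ • x) + s⁻¹ • y := by
      intro y
      rw [AffineMap.homothety_apply, vsub_eq_sub, vadd_eq_add, smul_sub]; abel
    ext z
    constructor
    · rintro ⟨⟨y, hy, rfl⟩, hz⟩
      exact ⟨s⁻¹ • y, ⟨y, ⟨hy, (hmem y).1 hz⟩, rfl⟩, (heq y).symm⟩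
    · rintro ⟨_, ⟨y, ⟨hy, hyb⟩, rfl⟩, rfl⟩
      have : (x - s⁻¹ • x) + s⁻¹ • y ∈ AffineMap.homothety x s⁻¹ '' F ∩ ball x 1 := by
        rw [← heq y]; exact ⟨⟨y, hy, rfl⟩, (hmem y).2 hyb⟩
      exact this
  rw [h]
  exact besselCapacity_vadd _ _ _ _

/-! ### Radii, slices and comparison of scales. -/

theorem radius_nonneg (t : ℝ) (n : ℕ) : 0 ≤ radius t n := Real.sqrt_nonneg _

theorem radius_succ_pos {t : ℝ} (ht : 0 < t) (n : ℕ) : 0 < radius t (n + 1) :=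
  Real.sqrt_pos.2 (by positivity)

theorem radius_sq {t : ℝ} (ht : 0 < t) (n : ℕ) : radius t n ^ 2 = n * t :=
  Real.sq_sqrt (by positivity)

theorem radius_mono {t : ℝ} (ht : 0 < t) : Monotone (radius t) := fun m n h =>
  Real.sqrt_le_sqrt (mul_le_mul_of_nonneg_right (by exact_mod_cast h) ht.le)

theorem sqrtMul_natCast {t : ℝ} (ht : 0 < t) (n : ℕ) :
    sqrtMul t n = ENNReal.ofReal (radius t n) := by
  rw [sqrtMul, radius, Real.sqrt_eq_rpow, ← ENNReal.ofReal_rpow_of_nonneg (by positivity)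
    (by positivity), mul_comm, ENNReal.ofReal_mul (by positivity)]
  simp

theorem sqrtMul_mono (t : ℝ) : Monotone (sqrtMul t) := fun m n h => by
  unfold sqrtMul
  gcongr

/-- The quantity `d_{n+1}^(N - 2/(q-1)) C_{2/q,q'}(F_n / d_{n+1})`. -/
noncomputable def sliceCap {N : ℕ} (q : ℝ) (F : Set (EuclideanSpace ℝ (Fin N)))
    (x : EuclideanSpace ℝ (Fin N)) (t : ℝ) (n : ℕ) : ℝ≥0∞ :=
  ENNReal.ofReal (radius t (n + 1) ^ ((N : ℝ) - 2 / (q - 1))) *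
    cap q ((radius t (n + 1))⁻¹ • slice F x t n)

theorem capacitaryPotential_eq (q : ℝ) (F : Set (EuclideanSpace ℝ (Fin N)))
    (x : EuclideanSpace ℝ (Fin N)) {t : ℝ} (ht : 0 < t) :
    capacitaryPotential q F x t = ENNReal.ofReal (t ^ (-(N : ℝ) / 2)) *
      ∑' n : ℕ, ENNReal.ofReal (Real.exp (-(n : ℝ) / 4)) * sliceCap q F x t n := by
  unfold capacitaryPotential sliceCap
  congr 2
  ext n
  have := radius_succ_pos ht n
  rw [ENNReal.ofReal_mul (by positivity)]
  ring

theorem slice_subset_closedBall {F : Set (EuclideanSpace ℝ (Fin N))}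
    {x : EuclideanSpace ℝ (Fin N)} {t : ℝ} {n : ℕ} :
    slice F x t n ⊆ closedBall x (radius t (n + 1)) := fun y hy => by
  rw [mem_closedBall, dist_comm, dist_eq_norm]; exact hy.2.2

theorem smul_subset_closedBall {E : Set (EuclideanSpace ℝ (Fin N))}
    {x : EuclideanSpace ℝ (Fin N)} {r s : ℝ} (hs : 0 < s) (hE : E ⊆ closedBall x r) :
    s⁻¹ • E ⊆ closedBall (s⁻¹ • x) (s / r)⁻¹ := by
  rintro _ ⟨y, hy, rfl⟩
  have h := mem_closedBall.1 (hE hy)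
  have : 0 < s⁻¹ := inv_pos.2 hs
  rw [mem_closedBall, dist_smul₀, norm_inv, Real.norm_of_nonneg hs.le, inv_div, div_eq_inv_mul]
  gcongr

/-- Comparison of the capacities of two dilates of a set `E` in the smaller of the two balls. -/
theorem rpow_mul_cap_le {q K : ℝ} (hK : ∀ (r : ℝ) (x : EuclideanSpace ℝ (Fin N))
      (E : Set (EuclideanSpace ℝ (Fin N))), 1 ≤ r → E ⊆ closedBall x r⁻¹ →
      cap q (r • E) ≤ ENNReal.ofReal (K * r ^ (N - 2 / (q - 1) + 1)) * cap q E)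
    {E : Set (EuclideanSpace ℝ (Fin N))} {x : EuclideanSpace ℝ (Fin N)} {r s : ℝ} (hK0 : 0 < K)
    (hr : 0 < r) (hrs : r ≤ s) (hE : E ⊆ closedBall x r) :
    ENNReal.ofReal (r ^ ((N : ℝ) - 2 / (q - 1))) * cap q (r⁻¹ • E) ≤
      ENNReal.ofReal (K * (s / r)) *
        (ENNReal.ofReal (s ^ ((N : ℝ) - 2 / (q - 1))) * cap q (s⁻¹ • E)) := by
  have hs : 0 < s := hr.trans_le hrs
  have h := hK (s / r) (s⁻¹ • x) (s⁻¹ • E) ((one_le_div hr).2 hrs) (smul_subset_closedBall hs hE)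
  rw [smul_smul, show s / r * s⁻¹ = r⁻¹ by field_simp] at h
  refine (mul_le_mul_right h _).trans (le_of_eq ?_)
  rw [← mul_assoc, ← mul_assoc, ← ENNReal.ofReal_mul (by positivity),
    ← ENNReal.ofReal_mul (by positivity)]
  congr 2
  rw [Real.rpow_add (by positivity), Real.rpow_one, Real.div_rpow hs.le hr.le]
  field_simp

theorem rpow_mul_cap_le_of_le {q : ℝ} (hN : 1 ≤ N) (hq : 1 + 2 / (N : ℝ) ≤ q)
    (E : Set (EuclideanSpace ℝ (Fin N))) {r s : ℝ} (hr : 0 < r) (hrs : r ≤ s) :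
    ENNReal.ofReal (s ^ ((N : ℝ) - 2 / (q - 1))) * cap q (s⁻¹ • E) ≤
      ENNReal.ofReal (r ^ ((N : ℝ) - 2 / (q - 1))) * cap q (r⁻¹ • E) := by
  have hs : 0 < s := hr.trans_le hrs
  have h := cap_smul_le_of_le_one hN hq (div_pos hr hs) ((div_le_one hs).2 hrs) (r⁻¹ • E)
  rw [smul_smul, show r / s * r⁻¹ = s⁻¹ by field_simp] at h
  refine (mul_le_mul_right h _).trans (le_of_eq ?_)
  rw [← mul_assoc, ← ENNReal.ofReal_mul (by positivity)]
  congr 2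
  rw [Real.div_rpow hr.le hs.le]
  field_simp

theorem radius_mul_sub_le {t : ℝ} (ht : 0 < t) (n : ℕ) :
    radius t (n + 1) * (radius t (n + 1) - radius t n) ≤ t := by
  have h1 := radius_sq ht n
  have h2 := radius_sq ht (n + 1)
  have h3 := radius_mono ht n.le_succ
  have h4 := radius_nonneg t n
  push_cast at h2
  nlinarith

theorem radius_succ_succ_le {t : ℝ} (ht : 0 < t) (n : ℕ) :
    radius t (n + 2) ≤ 2 * radius t (n + 1) := by
  have h1 := radius_sq ht (n + 1)
  have h2 := radius_sq ht (n + 2)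
  have h4 := radius_nonneg t (n + 1)
  push_cast at h1 h2
  refine abs_le_of_sq_le_sq' ?_ (by positivity) |>.2
  have : 0 ≤ n * t := by positivity
  nlinarith

/-- Since `d_{n+2}² - d_{n+1}² = t`, the product is `t d_{n+1}/(d_{n+1} + d_{n+2})`, and `d_{n+2} ≤
2 d_{n+1}`. -/
theorem le_radius_mul_sub {t : ℝ} (ht : 0 < t) (n : ℕ) :
    t ≤ 3 * (radius t (n + 1) * (radius t (n + 2) - radius t (n + 1))) := by
  have h1 := radius_sq ht (n + 1)
  have h2 := radius_sq ht (n + 2)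
  have h3 := radius_succ_succ_le ht n
  have h4 := radius_mono ht (n + 1).le_succ
  push_cast at h1 h2
  nlinarith

/-- A Cauchy product: `r^n = r^k r^(n-k)`, summed along antidiagonals. -/
theorem tsum_mul_sum_range_succ_le (a : ℕ → ℝ≥0∞) (r : ℝ≥0∞) :
    ∑' n, r ^ n * ∑ k ∈ Finset.range (n + 1), a k = (∑' n, r ^ n * a n) * ∑' m, r ^ m := by
  rw [← ENNReal.tsum_mul_right]
  simp_rw [← ENNReal.tsum_mul_left]
  rw [← ENNReal.tsum_prod (f := fun k m => r ^ k * a k * r ^ m),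
    ← Finset.HasAntidiagonal.sigmaAntidiagonalEquivProd.tsum_eq, ENNReal.tsum_sigma']
  refine tsum_congr fun n => ?_
  rw [tsum_fintype, Finset.mul_sum]
  have h1 := Finset.sum_coe_sort (Finset.HasAntidiagonal.antidiagonal n)
    (fun p : ℕ × ℕ => r ^ p.1 * a p.1 * r ^ p.2)
  refine Eq.trans ?_ h1.symm
  rw [Finset.Nat.sum_antidiagonal_eq_sum_range_succ (fun k m => r ^ k * a k * r ^ m)]
  refine Finset.sum_congr rfl fun k hk => ?_
  have hk : k ≤ n := Nat.lt_succ_iff.1 (Finset.mem_range.1 hk)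
  rw [mul_right_comm, ← pow_add, Nat.add_sub_cancel' hk]

theorem ofReal_exp_neg_div_four (n : ℕ) :
    ENNReal.ofReal (Real.exp (-(n : ℝ) / 4)) = ENNReal.ofReal (Real.exp (-(1 / 4))) ^ n := by
  rw [← ENNReal.ofReal_pow (Real.exp_pos _).le, ← Real.exp_nat_mul]
  congr 2; ring

/-- The integrand of `capacitaryIntegral`. -/
noncomputable def capacitaryIntegrand {N : ℕ} (q : ℝ) (F : Set (EuclideanSpace ℝ (Fin N)))
    (x : EuclideanSpace ℝ (Fin N)) (t s : ℝ) : ℝ≥0∞ :=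
  ENNReal.ofReal (s ^ ((N : ℝ) - 2 / (q - 1)) * Real.exp (-s ^ 2 / (4 * t))) *
    cap q (AffineMap.homothety x s⁻¹ '' F ∩ ball x 1) * ENNReal.ofReal s

theorem capacitaryIntegral_eq (q : ℝ) (F : Set (EuclideanSpace ℝ (Fin N)))
    (x : EuclideanSpace ℝ (Fin N)) (t a : ℝ) (b : ℝ≥0∞) :
    capacitaryIntegral q F x t a b = ENNReal.ofReal (t ^ (-(1 + (N : ℝ) / 2))) *
      ∫⁻ s in {s : ℝ | a < s ∧ ENNReal.ofReal s < b}, capacitaryIntegrand q F x t s := rfl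

theorem capacitaryIntegrand_eq (q : ℝ) (F : Set (EuclideanSpace ℝ (Fin N)))
    (x : EuclideanSpace ℝ (Fin N)) (t : ℝ) {s : ℝ} (hs : 0 < s) :
    capacitaryIntegrand q F x t s = ENNReal.ofReal (Real.exp (-s ^ 2 / (4 * t))) *
      (ENNReal.ofReal s * (ENNReal.ofReal (s ^ ((N : ℝ) - 2 / (q - 1))) *
        cap q (s⁻¹ • (F ∩ ball x s)))) := by
  rw [capacitaryIntegrand, cap_homothety F x hs, ENNReal.ofReal_mul (by positivity)]
  ring

theorem measurableSet_setOf_lt_ofReal_lt (a : ℝ) (b : ℝ≥0∞) :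
    MeasurableSet {s : ℝ | a < s ∧ ENNReal.ofReal s < b} :=
  (measurableSet_lt measurable_const measurable_id).inter
    (measurableSet_lt ENNReal.measurable_ofReal measurable_const)

/-- The capacity factor is at most that of the unit ball, and the remaining Gaussian moment
converges because `m + 1 > -1`. -/
theorem capacitaryIntegral_lt_top {q : ℝ} (hN : 1 ≤ N) (hq : 1 + 2 / (N : ℝ) ≤ q)
    (F : Set (EuclideanSpace ℝ (Fin N))) (x : EuclideanSpace ℝ (Fin N)) {t a : ℝ} (ht : 0 < t)
    (ha : 0 ≤ a) (b : ℝ≥0∞) : capacitaryIntegral q F x t a b < ∞ := by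
  obtain ⟨-, hle, -⟩ := two_div_sub_one_nonneg_le hN hq
  have hI := integrableOn_rpow_mul_exp_neg_mul_sq (b := 1 / (4 * t)) (by positivity)
    (s := (N : ℝ) - 2 / (q - 1) + 1) (by linarith)
  have hI' := hI.lintegral_lt_top
  refine ENNReal.mul_lt_top ENNReal.ofReal_lt_top (lt_of_le_of_lt ?_
    (ENNReal.mul_lt_top (cap_ball_lt_top hN hq x) hI'))
  rw [← lintegral_const_mul' _ _ (cap_ball_lt_top hN hq x).ne]
  refine (setLIntegral_mono' (measurableSet_setOf_lt_ofReal_lt a b) fun s hs => ?_).trans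
    (lintegral_mono_set (t := Ioi 0) fun s hs => ha.trans_lt hs.1)
  have hs0 : 0 < s := ha.trans_lt hs.1
  calc _ ≤ ENNReal.ofReal (s ^ ((N : ℝ) - 2 / (q - 1)) * Real.exp (-s ^ 2 / (4 * t))) *
        cap q (ball x 1) * ENNReal.ofReal s := by
        gcongr
        exact cap_mono q inter_subset_right
    _ = _ := by
        rw [mul_comm _ (cap q (ball x 1)), mul_assoc, ← ENNReal.ofReal_mul (by positivity)]
        congr 2
        rw [Real.rpow_add hs0, Real.rpow_one, show -s ^ 2 / (4 * t) = -(1 / (4 * t)) * s ^ 2 by ring]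
        ring

/-! ### The integral is bounded by the potential. -/

theorem lintegral_capacitaryIntegrand_le {q K : ℝ} (hN : 1 ≤ N) (hq : 1 + 2 / (N : ℝ) ≤ q)
    (hK0 : 0 < K) (hK : ∀ (r : ℝ) (x : EuclideanSpace ℝ (Fin N))
      (E : Set (EuclideanSpace ℝ (Fin N))), 1 ≤ r → E ⊆ closedBall x r⁻¹ →
      cap q (r • E) ≤ ENNReal.ofReal (K * r ^ (N - 2 / (q - 1) + 1)) * cap q E)
    (F : Set (EuclideanSpace ℝ (Fin N))) (x : EuclideanSpace ℝ (Fin N)) {t : ℝ} (ht : 0 < t)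
    (n : ℕ) :
    ∫⁻ s in Ioc (radius t n) (radius t (n + 1)), capacitaryIntegrand q F x t s ≤
      ENNReal.ofReal ((1 + K) * t) * (ENNReal.ofReal (Real.exp (-(n : ℝ) / 4)) *
        ∑ k ∈ Finset.range (n + 1), sliceCap q F x t k) := by
  obtain ⟨hq1, -, -⟩ := two_div_sub_one_nonneg_le hN hq
  obtain ⟨A, hA⟩ : ∃ A : ℝ≥0∞, A = ∑ k ∈ Finset.range (n + 1), sliceCap q F x t k := ⟨_, rfl⟩
  rw [← hA]
  have hd := radius_succ_pos ht n
  have hpt : ∀ s ∈ Ioc (radius t n) (radius t (n + 1)), capacitaryIntegrand q F x t s ≤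
      ENNReal.ofReal (Real.exp (-(n : ℝ) / 4)) *
        (ENNReal.ofReal ((1 + K) * radius t (n + 1)) * A) := by
    intro s hs
    have hs0 : 0 < s := (radius_nonneg t n).trans_lt hs.1
    rw [capacitaryIntegrand_eq q F x t hs0]
    have hexp : -s ^ 2 / (4 * t) ≤ -(n : ℝ) / 4 := by
      rw [neg_div, neg_div, neg_le_neg_iff, div_le_div_iff₀ (by norm_num) (by positivity)]
      have h1 := radius_sq ht n
      have h2 := pow_le_pow_left₀ (radius_nonneg t n) hs.1.le 2
      nlinarith
    refine mul_le_mul' (ENNReal.ofReal_le_ofReal (Real.exp_le_exp.2 hexp)) ?_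
    -- Slices with `k < n` have `d_{k+1} ≤ s`, so the monotone comparison applies to them. The last
    -- one must be cut to the ball of radius `s`, because its reference scale `d_{n+1}` is the
    -- larger one and that comparison needs confinement.
    have hcover : F ∩ ball x s ⊆ (⋃ k ∈ Finset.range n, slice F x t k) ∪
        (slice F x t n ∩ closedBall x s) := by
      rintro y ⟨hyF, hy⟩
      rw [mem_ball, dist_comm, dist_eq_norm] at hy
      obtain ⟨k, hk, hle⟩ : ∃ k : ℕ, k ≤ n ∧ radius t k ≤ ‖x - y‖ ∧ ‖x - y‖ ≤ radius t (k + 1) := by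
        have hex : ∃ k : ℕ, ‖x - y‖ ≤ radius t (k + 1) := ⟨n, hy.le.trans hs.2⟩
        classical
        refine ⟨Nat.find hex, Nat.find_min' hex (hy.le.trans hs.2), ?_, Nat.find_spec hex⟩
        rcases hfind : Nat.find hex with _ | m
        · simp [radius]
        · exact (not_le.1 (Nat.find_min hex (m := m) (by omega))).le
      rcases hk.lt_or_eq with hk | rfl
      · exact Or.inl (mem_iUnion₂.2 ⟨k, Finset.mem_range.2 hk, hyF, hle⟩)
      · refine Or.inr ⟨⟨hyF, hle⟩, ?_⟩
        rw [mem_closedBall, dist_comm, dist_eq_norm]; exact hy.le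
    have hcap : cap q (s⁻¹ • (F ∩ ball x s)) ≤ (∑ k ∈ Finset.range n,
        cap q (s⁻¹ • slice F x t k)) + cap q (s⁻¹ • (slice F x t n ∩ closedBall x s)) := by
      refine (cap_mono q (smul_set_mono hcover)).trans ?_
      rw [smul_set_union, smul_set_iUnion₂]
      exact (besselCapacity_union_le _ _ _ _).trans (add_le_add_left
        (besselCapacity_biUnion_range_le _ (div_pos (by linarith) (by linarith)) _ _) _)
    have hlast := rpow_mul_cap_le hK (x := x) hK0 hs0 hs.2
      (inter_subset_right : slice F x t n ∩ closedBall x s ⊆ closedBall x s)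
    calc _ ≤ ENNReal.ofReal s * (ENNReal.ofReal (s ^ ((N : ℝ) - 2 / (q - 1))) *
          ((∑ k ∈ Finset.range n, cap q (s⁻¹ • slice F x t k)) +
            cap q (s⁻¹ • (slice F x t n ∩ closedBall x s)))) := by gcongr
      _ ≤ ENNReal.ofReal s * ((∑ k ∈ Finset.range n, sliceCap q F x t k) +
            ENNReal.ofReal (K * (radius t (n + 1) / s)) * sliceCap q F x t n) := by
          rw [mul_add, Finset.mul_sum]
          refine mul_le_mul_right (add_le_add (Finset.sum_le_sum fun k hk => ?_)
            (hlast.trans ?_)) _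
          · exact rpow_mul_cap_le_of_le hN hq _ (radius_succ_pos ht k)
              ((radius_mono ht (Finset.mem_range.1 hk)).trans hs.1.le)
          · refine mul_le_mul_right (mul_le_mul_right (cap_mono q ?_) _) _
            exact smul_set_mono inter_subset_left
      -- The weight `s` cancels the loss `d_{n+1}/s`, which would be unbounded near `s = 0` when `n
      -- = 0`.
      _ ≤ ENNReal.ofReal (radius t (n + 1)) * A + ENNReal.ofReal (K * radius t (n + 1)) * A := by
          rw [mul_add, ← mul_assoc, ← ENNReal.ofReal_mul hs0.le]
          refine add_le_add (mul_le_mul' (ENNReal.ofReal_le_ofReal hs.2) ?_)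
            (mul_le_mul' (le_of_eq ?_) ?_)
          · rw [hA, Finset.sum_range_succ]; exact le_self_add
          · congr 1; field_simp
          · rw [hA, Finset.sum_range_succ]; exact le_add_self
      _ = _ := by
          rw [← add_mul, ← ENNReal.ofReal_add hd.le (by positivity)]
          congr 2; ring
  refine (setLIntegral_mono' measurableSet_Ioc hpt).trans ?_
  rw [setLIntegral_const, Real.volume_Ioc, mul_assoc, mul_right_comm,
    ← ENNReal.ofReal_mul (by positivity), mul_left_comm]
  refine mul_le_mul_left (ENNReal.ofReal_le_ofReal ?_) _
  rw [mul_assoc]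
  exact mul_le_mul_of_nonneg_left (radius_mul_sub_le ht n) (by positivity)

theorem Ioi_zero_subset_iUnion_Ioc_radius {t : ℝ} (ht : 0 < t) :
    Ioi (0 : ℝ) ⊆ ⋃ n, Ioc (radius t n) (radius t (n + 1)) := by
  intro s hs
  have hs : 0 < s := hs
  have hex : ∃ k : ℕ, s ≤ radius t (k + 1) := by
    obtain ⟨k, hk⟩ := exists_nat_ge (s ^ 2 / t)
    refine ⟨k, Real.le_sqrt_of_sq_le ?_⟩
    rw [div_le_iff₀ ht] at hk
    push_cast
    nlinarith
  classical
  refine mem_iUnion.2 ⟨Nat.find hex, ?_, Nat.find_spec hex⟩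
  rcases hfind : Nat.find hex with _ | m
  · simpa [radius] using hs
  · exact not_le.1 (Nat.find_min hex (m := m) (by omega))

theorem exists_capacitaryIntegral_le {q : ℝ} (hN : 1 ≤ N) (hq : 1 + 2 / (N : ℝ) ≤ q) :
    ∃ C : ℝ≥0, 0 < C ∧ ∀ (F : Set (EuclideanSpace ℝ (Fin N))) (x : EuclideanSpace ℝ (Fin N))
      (t : ℝ) (b : ℝ≥0∞), 0 < t →
      capacitaryIntegral q F x t 0 b ≤ C * capacitaryPotential q F x t := by
  obtain ⟨K, hK0, hK⟩ := exists_cap_smul_le hN hq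
  obtain ⟨G, hG⟩ : ∃ G : ℝ≥0∞, G = ∑' m : ℕ, ENNReal.ofReal (Real.exp (-(1 / 4))) ^ m := ⟨_, rfl⟩
  have hGt : G ≠ ∞ := by
    rw [hG, ENNReal.tsum_geometric]
    refine ENNReal.inv_ne_top.2 (tsub_pos_of_lt ?_).ne'
    rw [ENNReal.ofReal_lt_one, Real.exp_lt_one_iff]
    norm_num
  have hG0 : G ≠ 0 := by
    rw [hG]
    exact fun h => by simpa using ENNReal.tsum_eq_zero.1 h 0
  lift G to ℝ≥0 using hGt
  have hG0 : 0 < G := pos_iff_ne_zero.2 (by exact_mod_cast hG0)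
  refine ⟨(1 + K).toNNReal * G, mul_pos (Real.toNNReal_pos.2 (by linarith)) hG0,
    fun F x t b ht => ?_⟩
  have h1 : ∫⁻ s in {s : ℝ | 0 < s ∧ ENNReal.ofReal s < b}, capacitaryIntegrand q F x t s ≤
      ENNReal.ofReal ((1 + K) * t) *
        ((∑' n : ℕ, ENNReal.ofReal (Real.exp (-(n : ℝ) / 4)) * sliceCap q F x t n) * G) := by
    calc _ ≤ ∫⁻ s in ⋃ n, Ioc (radius t n) (radius t (n + 1)), capacitaryIntegrand q F x t s :=
          lintegral_mono_set fun s hs => Ioi_zero_subset_iUnion_Ioc_radius ht hs.1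
      _ ≤ ∑' n, ∫⁻ s in Ioc (radius t n) (radius t (n + 1)), capacitaryIntegrand q F x t s :=
          lintegral_iUnion_le _ _
      _ ≤ ∑' n : ℕ, ENNReal.ofReal ((1 + K) * t) * (ENNReal.ofReal (Real.exp (-(n : ℝ) / 4)) *
            ∑ k ∈ Finset.range (n + 1), sliceCap q F x t k) :=
          ENNReal.tsum_le_tsum fun n => lintegral_capacitaryIntegrand_le hN hq hK0 hK F x ht n
      _ = _ := by
          rw [ENNReal.tsum_mul_left]
          simp_rw [ofReal_exp_neg_div_four]
          rw [tsum_mul_sum_range_succ_le, hG]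
  rw [capacitaryIntegral_eq, capacitaryPotential_eq q F x ht]
  refine (mul_le_mul_right h1 _).trans (le_of_eq ?_)
  have h2 : t ^ (-(N : ℝ) / 2) = t ^ (-(1 + (N : ℝ) / 2)) * t := by
    nth_rewrite 3 [← Real.rpow_one t]
    rw [← Real.rpow_add ht]
    congr 1; ring
  rw [h2, ENNReal.ofReal_mul (p := t ^ (-(1 + (N : ℝ) / 2))) (by positivity),
    ENNReal.ofReal_mul (p := 1 + K) (by linarith), ENNReal.coe_mul, ← ENNReal.ofReal]
  ring

/-! ### The potential is bounded by the integral. -/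

theorem slice_eq_empty_of_upperIndex_lt {F : Set (EuclideanSpace ℝ (Fin N))}
    {x : EuclideanSpace ℝ (Fin N)} {t : ℝ} (ht : 0 < t) {n : ℕ}
    (h : upperIndex F x t < n) : slice F x t n = ∅ := by
  unfold upperIndex at h
  simp only [iInf_lt_iff] at h
  obtain ⟨j, hF, hj⟩ := h
  refine eq_empty_of_forall_notMem fun y hy => ?_
  have h1 := hF hy.1
  rw [mem_ball, dist_comm, dist_eq_norm] at h1
  have h2 : radius t (j + 1) ≤ radius t n := radius_mono ht (by exact_mod_cast hj)
  rw [radius] at h2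
  push_cast at h2
  linarith [hy.2.1]

/-- The interval is shifted by one so that the closed slice `F_n` lies in the open ball `B_s(x)`. In
the constant, `6 = 2 · 3`: the ratio of consecutive radii is at most 2, and the mass of the interval
is at least `t/3`. -/
theorem sliceCap_le_lintegral {q K : ℝ} (hK0 : 0 < K) (hK : ∀ (r : ℝ)
      (x : EuclideanSpace ℝ (Fin N)) (E : Set (EuclideanSpace ℝ (Fin N))),
      1 ≤ r → E ⊆ closedBall x r⁻¹ →
      cap q (r • E) ≤ ENNReal.ofReal (K * r ^ (N - 2 / (q - 1) + 1)) * cap q E)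
    (F : Set (EuclideanSpace ℝ (Fin N))) (x : EuclideanSpace ℝ (Fin N)) {t : ℝ} (ht : 0 < t)
    (n : ℕ) :
    ENNReal.ofReal t * (ENNReal.ofReal (Real.exp (-(n : ℝ) / 4)) * sliceCap q F x t n) ≤
      ENNReal.ofReal (6 * K * Real.exp (1 / 2)) *
        ∫⁻ s in Ioo (radius t (n + 1)) (radius t (n + 2)), capacitaryIntegrand q F x t s := by
  have hd := radius_succ_pos ht n
  have hpt : ∀ s ∈ Ioo (radius t (n + 1)) (radius t (n + 2)),
      ENNReal.ofReal (radius t (n + 1)) *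
        (ENNReal.ofReal (Real.exp (-(n : ℝ) / 4)) * sliceCap q F x t n) ≤
      ENNReal.ofReal (2 * K * Real.exp (1 / 2)) * capacitaryIntegrand q F x t s := by
    intro s hs
    have hs0 : 0 < s := hd.trans hs.1
    rw [capacitaryIntegrand_eq q F x t hs0]
    -- From `s² ≤ (n+2)t`: the index shift costs a factor `e^{1/2}`.
    have hexp : -(n : ℝ) / 4 ≤ 1 / 2 + -s ^ 2 / (4 * t) := by
      have h1 := radius_sq ht (n + 2)
      have h2 := pow_le_pow_left₀ hs0.le hs.2.le 2
      have h3 : s ^ 2 / (4 * t) ≤ (n + 2) / 4 := by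
        rw [div_le_div_iff₀ (by positivity) (by norm_num)]
        push_cast at h1
        nlinarith
      rw [neg_div (4 * t)]
      linarith
    have hexp' := Real.exp_le_exp.2 hexp
    rw [Real.exp_add] at hexp'
    have hsub : slice F x t n ⊆ F ∩ ball x s := fun y hy =>
      ⟨hy.1, mem_ball.2 ((mem_closedBall.1 (slice_subset_closedBall hy)).trans_lt hs.1)⟩
    have h4 := rpow_mul_cap_le hK (x := x) hK0 hd hs.1.le (slice_subset_closedBall (F := F) (n := n))
    have h5 : sliceCap q F x t n ≤ ENNReal.ofReal (2 * K) *
        (ENNReal.ofReal (s ^ ((N : ℝ) - 2 / (q - 1))) * cap q (s⁻¹ • (F ∩ ball x s))) := by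
      refine h4.trans (mul_le_mul' (ENNReal.ofReal_le_ofReal ?_)
        (mul_le_mul_right (cap_mono q (smul_set_mono hsub)) _))
      · rw [mul_comm 2]
        refine mul_le_mul_of_nonneg_left ((div_le_iff₀ hd).2 ?_) hK0.le
        exact hs.2.le.trans (radius_succ_succ_le ht n)
    calc _ ≤ ENNReal.ofReal s *
          (ENNReal.ofReal (Real.exp (1 / 2) * Real.exp (-s ^ 2 / (4 * t))) *
          (ENNReal.ofReal (2 * K) * (ENNReal.ofReal (s ^ ((N : ℝ) - 2 / (q - 1))) *
            cap q (s⁻¹ • (F ∩ ball x s))))) := by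
          gcongr
          exact hs.1.le
      _ = _ := by
          rw [ENNReal.ofReal_mul (by positivity), ENNReal.ofReal_mul (p := 2 * K) (by positivity)]
          ring
  have hint := setLIntegral_mono' (μ := volume) measurableSet_Ioo hpt
  rw [setLIntegral_const, Real.volume_Ioo, lintegral_const_mul' _ _ ENNReal.ofReal_ne_top] at hint
  calc _ ≤ ENNReal.ofReal (3 * (radius t (n + 1) * (radius t (n + 2) - radius t (n + 1)))) *
        (ENNReal.ofReal (Real.exp (-(n : ℝ) / 4)) * sliceCap q F x t n) := by
        gcongr
        exact le_radius_mul_sub ht n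
    _ = ENNReal.ofReal 3 * (ENNReal.ofReal (radius t (n + 1)) *
        (ENNReal.ofReal (Real.exp (-(n : ℝ) / 4)) * sliceCap q F x t n) *
          ENNReal.ofReal (radius t (n + 2) - radius t (n + 1))) := by
        rw [ENNReal.ofReal_mul (by norm_num), ENNReal.ofReal_mul hd.le]
        ring
    _ ≤ _ := mul_le_mul_right hint _
    _ = _ := by
        rw [← mul_assoc, ← ENNReal.ofReal_mul (by norm_num)]
        congr 2; ring

theorem exists_capacitaryPotential_le {q : ℝ} (hN : 1 ≤ N) (hq : 1 + 2 / (N : ℝ) ≤ q) :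
    ∃ C : ℝ≥0, 0 < C ∧ ∀ (F : Set (EuclideanSpace ℝ (Fin N))) (x : EuclideanSpace ℝ (Fin N))
      (t : ℝ), 0 < t → capacitaryPotential q F x t ≤
        C * capacitaryIntegral q F x t (Real.sqrt t) (sqrtMul t (upperIndex F x t + 2)) := by
  obtain ⟨hq1, -, -⟩ := two_div_sub_one_nonneg_le hN hq
  obtain ⟨K, hK0, hK⟩ := exists_cap_smul_le hN hq
  refine ⟨(6 * K * Real.exp (1 / 2)).toNNReal, Real.toNNReal_pos.2 (by positivity),
    fun F x t ht => ?_⟩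
  obtain ⟨U, hU⟩ : ∃ U : Set ℝ, U = {s : ℝ | Real.sqrt t < s ∧
    ENNReal.ofReal s < sqrtMul t (upperIndex F x t + 2)} := ⟨_, rfl⟩
  have hUm : MeasurableSet U := by rw [hU]; exact measurableSet_setOf_lt_ofReal_lt _ _
  have hterm : ∀ n : ℕ,
      ENNReal.ofReal t * (ENNReal.ofReal (Real.exp (-(n : ℝ) / 4)) * sliceCap q F x t n) ≤
      ENNReal.ofReal (6 * K * Real.exp (1 / 2)) * ∫⁻ s in
        Ioo (radius t (n + 1)) (radius t (n + 2)) ∩ U, capacitaryIntegrand q F x t s := by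
    intro n
    -- For `n > a_t'` the slice is empty; for `n ≤ a_t'` the interval ends at `d_{n+2} ≤
    -- √(t(a_t'+2))` and starts at or after `√t`, hence lies in `U`.
    rcases lt_or_ge (upperIndex F x t) n with h | h
    · have h0 : cap q (∅ : Set (EuclideanSpace ℝ (Fin N))) = 0 :=
        besselCapacity_empty _ (div_pos (by linarith) (by linarith))
      rw [sliceCap, slice_eq_empty_of_upperIndex_lt ht h, smul_set_empty, h0]
      simp
    · have hsub : Ioo (radius t (n + 1)) (radius t (n + 2)) ⊆ U := by
        intro s hs
        rw [hU]
        have hs0 : 0 < s := (radius_succ_pos ht n).trans hs.1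
        constructor
        · have h1 : radius t 1 ≤ radius t (n + 1) := radius_mono ht (by omega)
          have h2 : radius t 1 = Real.sqrt t := by simp [radius]
          exact h2 ▸ h1.trans_lt hs.1
        · refine lt_of_lt_of_le ?_ (sqrtMul_mono t (add_le_add_left h 2))
          have := sqrtMul_natCast ht (n + 2)
          push_cast at this
          rw [this]
          exact (ENNReal.ofReal_lt_ofReal_iff_of_nonneg hs0.le).2 hs.2
      rw [inter_eq_left.2 hsub]
      exact sliceCap_le_lintegral hK0 hK F x ht n
  have hdisj : Pairwise (Function.onFun Disjoint
      fun n : ℕ => Ioo (radius t (n + 1)) (radius t (n + 2)) ∩ U) := by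
    refine (pairwise_disjoint_on _).2 fun m n hmn => ?_
    refine Set.disjoint_left.2 fun s hs hs' => ?_
    have := radius_mono ht (show m + 2 ≤ n + 1 by omega)
    linarith [hs.1.2, hs'.1.1]
  have hsum : ENNReal.ofReal t *
      ∑' n : ℕ, ENNReal.ofReal (Real.exp (-(n : ℝ) / 4)) * sliceCap q F x t n ≤
      ENNReal.ofReal (6 * K * Real.exp (1 / 2)) * ∫⁻ s in U, capacitaryIntegrand q F x t s := by
    rw [← ENNReal.tsum_mul_left]
    refine (ENNReal.tsum_le_tsum hterm).trans ?_
    rw [ENNReal.tsum_mul_left, ← lintegral_iUnion (fun n => measurableSet_Ioo.inter hUm) hdisj]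
    exact mul_le_mul_right (lintegral_mono_set (iUnion_subset fun n => inter_subset_right)) _
  rw [capacitaryIntegral_eq, capacitaryPotential_eq q F x ht, ← hU]
  have h2 : t ^ (-(N : ℝ) / 2) = t ^ (-(1 + (N : ℝ) / 2)) * t := by
    nth_rewrite 3 [← Real.rpow_one t]
    rw [← Real.rpow_add ht]
    congr 1; ring
  rw [h2, ENNReal.ofReal_mul (by positivity), mul_assoc, mul_left_comm (_ : ℝ≥0∞) _ (∫⁻ _ in U, _)]
  exact mul_le_mul_right hsum _

end ParabolicCapacity

open ParabolicCapacity in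
theorem proposition4p2 (N : ℕ) (hN : 1 ≤ N) (q : ℝ) (hq : 1 + 2 / (N : ℝ) ≤ q)
    (T : ℝ≥0∞) (hT : 0 < T) :
    ∃ C₁ C₂ : ℝ≥0, 0 < C₁ ∧ 0 < C₂ ∧
      ∀ F : Set (EuclideanSpace ℝ (Fin N)), IsClosed F →
        ∀ (x : EuclideanSpace ℝ (Fin N)) (t : ℝ), 0 < t → ENNReal.ofReal t ≤ T →
          (C₂ : ℝ≥0∞) * capacitaryIntegral q F x t 0 (sqrtMul t (lowerIndex F x t)) ≤
              capacitaryPotential q F x t ∧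
          capacitaryPotential q F x t ≤
              (C₁ : ℝ≥0∞) * capacitaryIntegral q F x t (Real.sqrt t)
                (sqrtMul t (upperIndex F x t + 2)) ∧
          capacitaryIntegral q F x t (Real.sqrt t) (sqrtMul t (upperIndex F x t + 2)) < ∞ := by
  obtain ⟨C₁, hC₁, h₁⟩ := exists_capacitaryPotential_le hN hq
  obtain ⟨C, hC, h⟩ := exists_capacitaryIntegral_le hN hq
  -- Finiteness of the right-hand integral passes down the chain of inequalities to the other two
  -- quantities, as both constants are positive and finite.
  refine ⟨C₁, C⁻¹, hC₁, inv_pos.2 hC, fun F _ x t ht _ => ⟨?_, h₁ F x t ht,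
    capacitaryIntegral_lt_top hN hq F x ht (Real.sqrt_nonneg t) _⟩⟩
  calc _ ≤ ((C⁻¹ : ℝ≥0) : ℝ≥0∞) * (C * capacitaryPotential q F x t) :=
        mul_le_mul_right (h F x t _ ht) _
    _ = _ := by
        rw [← mul_assoc, ← ENNReal.coe_mul, inv_mul_cancel₀ hC.ne', ENNReal.coe_one, one_mul]
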